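/- Let $(M,d)$ be a complete metric space, $\mathbf m$ a Radon measure on $M$ that is finite on bounded sets, and $1<p<\infty$. Convergence in $L^0(\mathbf m)$ means convergence in measure on every measurable set of finite measure. For a Lipschitz function $f:M\to\mathbb R$ let $\operatorname{lip}f(x)=\limsup_{y\to x,\,y\neq x}\frac{|f(y)-f(x)|}{d(y,x)}$ (with value $0$ at isolated points), and let $D(\mathcal F^{\operatorname{lip}}_p)$ be the vector space of Lipschitz functions $f$ with $\operatorname{lip}f\in L^p(\mathbf m)$. *Relaxations.* A function $G\in L^p(\mathbf m)$ is an upper relaxation at $f\in L^0(\mathbf m)$ if there are $f_n\in D(\mathcal F^{\operatorname{lip}}_p)$ with $f_n\to f$ in $L^0(\mathbf m)$ and $\operatorname{lip}f_n\rightharpoonup\tilde G$ weakly in $L^p(\mathbf m)$, $\tilde G\le G$ a.e. It is a strong upper relaxation at $f$ if moreover there are $f_n\in D(\mathcal F^{\operatorname{lip}}_p)$ with $f_n\to f$ in $L^0(\mathbf m)$ such that $\operatorname{lip}h_n\to G$ strongly in $L^p(\mathbf m)$ for every choice of finite convex combinations $h_n$ of $\{f_k\}_{k\ge n}$. Let $D(\mathcal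 F_p)$ be the set of $f\in L^0(\mathbf m)$ for which $\liminf_n\int(\operatorname{lip}f_n)^p\,d\mathbf m<\infty$ for some $D(\mathcal F^{\operatorname{lip}}_p)\ni f_n\to f$ in $L^0(\mathbf m)$; for such $f$ the relaxed slope $|Df|_{*,p}\in L^p(\mathbf m)$ is the greatest $G\in L^p(\mathbf m)$ with $G\le\tilde G$ a.e. whenever $D(\mathcal F^{\operatorname{lip}}_p)\ni f_n\to f$ in $L^0(\mathbf m)$ and $\operatorname{lip}f_n\rightharpoonup\tilde G$ weakly in $L^p(\mathbf m)$. *Modules.* Let $f\mapsto g_f$ be a subadditive, absolutely homogeneous map from a vector space $D$ of functions to nonnegative functions in $L^p(\mathbf m)$. Consider the families $\{(f_i,A_i)\}_{i\in\mathbb N}$ with $f_i\in D$, $(A_i)$ a Borel partition of $M$ and $\sum_i\int_{A_i}g_{f_i}^p\,d\mathbf m<\infty$, with pointwise norm $|[(f_i,A_i)_i]|=g_{f_i}$ on $A_i$ and norm $\||\cdot|\|_{L^p}$, where $\{(f_i,A_i)\}\sim\{(h_j,B_j)\}$ if $g_{f_i-h_j}=0$ a.e. on $A_i\cap B_j$ for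 all $i,j$. The module generated by $f\mapsto g_f$ is the completion of the quotient space; it is an $L^p(\mathbf m)$-normed module: it carries a pointwise norm and a multiplication by $L^\infty(\mathbf m)$, extended by continuity from $a\cdot[(f_i,A_i)_i]=[(a_jf_i,A_i\cap B_j)_{i,j}]$ for $a=\sum_ja_j\chi_{B_j}$, and $f\in D$ has the differential $[f,M]$. The $L^p$-Lipschitz module $L^p_{\operatorname{lip}}(T^*M)$, with differential $d_{\operatorname{lip}}$, is generated by $f\mapsto\operatorname{lip}f$ on $D(\mathcal F^{\operatorname{lip}}_p)$; the $L^p$-cotangent module $L^p(T^*M)$, with differential $d_p$, is generated by $f\mapsto|Df|_{*,p}$ on $D(\mathcal F_p)$. **Theorem.** Assume that every strong upper relaxation at $0$ vanishes $\mathbf m$-a.e. Then: 1. $f\mapsto\int(\operatorname{lip}f)^p\,d\mathbf m$ is lower semicontinuous on $D(\mathcal F^{\operatorname{lip}}_p)$ with respect to convergence in $L^0(\mathbf m)$. 2. $d_{\operatorname{lip}}$ is closable from $L^0(\mathbf m)$ to $L^p_{\operatorname{lip}}(T^*M)$: if $f_n\in D(\mathcal F^{\operatorname{lip}}_p)$,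 $f_n\to0$ in $L^0(\mathbf m)$ and $d_{\operatorname{lip}}f_n\to\omega$, then $\omega=0$. 3. $L^p_{\operatorname{lip}}(T^*M)$ is a submodule of $L^p(T^*M)$: there is a unique linear isometric embedding $i:L^p_{\operatorname{lip}}(T^*M)\to L^p(T^*M)$ that commutes with multiplication by $L^\infty(\mathbf m)$, preserves the pointwise norm and satisfies $i(d_{\operatorname{lip}}f)=d_pf$ for all $f\in D(\mathcal F^{\operatorname{lip}}_p)$; its image is a closed subspace, stable under multiplication by $L^\infty(\mathbf m)$, which is itself an $L^p(\mathbf m)$-normed module (in particular it has the locality and glueing properties). 4. If $\{d_pf: f\in D(\mathcal F^{\operatorname{lip}}_p)\}$ is dense in $\{d_pf: f\in D(\mathcal F_p)\}$ with respect to the norm of $L^p(T^*M)$, then $i$ is onto, i.e. the two modules agree. -/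

import Mathlib

open MeasureTheory Filter Topology Set
open scoped ENNReal NNReal

/-! ### Uniform convexity of `L^p` on nonnegative functions -/

theorem rpow_uniform_convexity {r : ℝ} (hr : 1 < r) {ε : ℝ} (hε : 0 < ε) :
    ∃ C : ℝ, 0 ≤ C ∧ ∀ a b : ℝ, 0 ≤ a → 0 ≤ b →
      |a - b| ^ r ≤ ε * (a ^ r + b ^ r) + C * ((a ^ r + b ^ r) / 2 - ((a + b) / 2) ^ r) := by
  have hr0 : 0 < r := by linarith
  set φ : ℝ × ℝ → ℝ := fun z => (z.1 ^ r + z.2 ^ r) / 2 - ((z.1 + z.2) / 2) ^ r with hφ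
  have hφc : Continuous φ := by
    have h1 : Continuous fun x : ℝ => x ^ r := Real.continuous_rpow_const hr0.le
    exact (((h1.comp continuous_fst).add (h1.comp continuous_snd)).div_const 2).sub
      (h1.comp ((continuous_fst.add continuous_snd).div_const 2))
  have hφ0 : ∀ a b : ℝ, 0 ≤ a → 0 ≤ b → 0 ≤ φ (a, b) := by
    intro a b ha hb
    have := (strictConvexOn_rpow hr).convexOn.2 ha hb (by norm_num : (0:ℝ) ≤ 1/2)
      (by norm_num : (0:ℝ) ≤ 1/2) (by norm_num)
    simp only [smul_eq_mul] at this
    simp only [hφ]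
    have e : (a + b) / 2 = 1 / 2 * a + 1 / 2 * b := by ring
    rw [e]; linarith
  have hφpos : ∀ a b : ℝ, 0 ≤ a → 0 ≤ b → a ≠ b → 0 < φ (a, b) := by
    intro a b ha hb hab
    have := (strictConvexOn_rpow hr).2 ha hb hab (by norm_num : (0:ℝ) < 1/2)
      (by norm_num : (0:ℝ) < 1/2) (by norm_num)
    simp only [smul_eq_mul] at this
    simp only [hφ]
    have e : (a + b) / 2 = 1 / 2 * a + 1 / 2 * b := by ring
    rw [e]; linarith
  set K : Set (ℝ × ℝ) := {z | z ∈ Icc (0:ℝ) 1 ×ˢ Icc (0:ℝ) 1 ∧ max z.1 z.2 = 1 ∧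
    ε ≤ |z.1 - z.2| ^ r} with hK
  have hKc : IsCompact K := by
    refine (isCompact_Icc.prod isCompact_Icc).inter_right (t := {z : ℝ × ℝ | max z.1 z.2 = 1 ∧
      ε ≤ |z.1 - z.2| ^ r}) ?_
    have h2 : Continuous fun z : ℝ × ℝ => |z.1 - z.2| ^ r :=
      (Real.continuous_rpow_const hr0.le).comp (continuous_fst.sub continuous_snd).abs
    exact (isClosed_eq (continuous_fst.max continuous_snd) continuous_const).inter
      (isClosed_le continuous_const h2)
  obtain ⟨c, hc, hcK⟩ : ∃ c : ℝ, 0 < c ∧ ∀ z ∈ K, c ≤ φ z := by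
    rcases K.eq_empty_or_nonempty with h | h
    · exact ⟨1, one_pos, by simp [h]⟩
    · obtain ⟨z, hz, hmin⟩ := hKc.exists_isMinOn h hφc.continuousOn
      refine ⟨φ z, hφpos z.1 z.2 hz.1.1.1 hz.1.2.1 ?_, fun w hw => hmin hw⟩
      intro heq
      have := hz.2.2
      rw [heq, sub_self, abs_zero, Real.zero_rpow hr0.ne'] at this
      linarith
  refine ⟨1 / c, by positivity, fun a b ha hb => ?_⟩
  set t := max a b with ht
  have ht0 : 0 ≤ t := le_max_of_le_left ha
  have har := Real.rpow_nonneg ha r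
  have hbr := Real.rpow_nonneg hb r
  have hnn : 0 ≤ 1 / c * φ (a, b) := mul_nonneg (by positivity) (hφ0 a b ha hb)
  have hnn' : 0 ≤ ε * (a ^ r + b ^ r) := by positivity
  change _ ≤ ε * (a ^ r + b ^ r) + 1 / c * φ (a, b)
  rcases ht0.eq_or_lt with h0 | htpos
  · have ha' : a = 0 := le_antisymm (h0 ▸ le_max_left a b) ha
    have hb' : b = 0 := le_antisymm (h0 ▸ le_max_right a b) hb
    have : |a - b| ^ r = 0 := by simp [ha', hb', Real.zero_rpow hr0.ne']
    linarith
  have htr : t ^ r ≤ a ^ r + b ^ r := by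
    rcases max_choice a b with h | h <;> rw [ht, h] <;> linarith
  have htrpos : 0 < t ^ r := Real.rpow_pos_of_pos htpos r
  have hat : a / t ≤ 1 := (div_le_one htpos).2 (le_max_left a b)
  have hbt : b / t ≤ 1 := (div_le_one htpos).2 (le_max_right a b)
  have hscale : |a / t - b / t| ^ r = |a - b| ^ r / t ^ r := by
    rw [← sub_div, abs_div, abs_of_pos htpos, Real.div_rpow (abs_nonneg _) ht0]
  have hφs : φ (a / t, b / t) = φ (a, b) / t ^ r := by
    simp only [hφ]
    rw [Real.div_rpow ha ht0, Real.div_rpow hb ht0,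
      show (a / t + b / t) / 2 = ((a + b) / 2) / t by ring,
      Real.div_rpow (by positivity) ht0]
    ring
  by_cases hsep : ε ≤ |a / t - b / t| ^ r
  · have hmem : (a / t, b / t) ∈ K := by
      refine ⟨⟨⟨by positivity, hat⟩, ⟨by positivity, hbt⟩⟩, ?_, hsep⟩
      change max (a / t) (b / t) = 1
      rw [max_div_div_right ht0, ← ht, div_self htpos.ne']
    have h1 := hcK _ hmem
    rw [hφs, le_div_iff₀ htrpos] at h1
    have h2 : |a - b| ^ r ≤ t ^ r := by
      refine Real.rpow_le_rpow (abs_nonneg _) ?_ hr0.le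
      rw [abs_le]
      constructor <;> linarith [le_max_left a b, le_max_right a b]
    have h3 : t ^ r ≤ 1 / c * φ (a, b) := by
      rw [one_div, ← div_eq_inv_mul, le_div_iff₀ hc]; linarith
    linarith
  · push Not at hsep
    rw [hscale, div_lt_iff₀ htrpos] at hsep
    have : ε * t ^ r ≤ ε * (a ^ r + b ^ r) := mul_le_mul_of_nonneg_left htr hε.le
    linarith

section Lp
variable {M : Type*} [MeasurableSpace M] {m : Measure M} {p : ℝ≥0∞}

theorem Lp_norm_rpow_eq_integral (hp1 : 1 < p) (hp : p ≠ ∞) (u : Lp ℝ p m) :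
    ‖u‖ ^ p.toReal = ∫ x, |u x| ^ p.toReal ∂m := by
  have hp0 : p ≠ 0 := (zero_lt_one.trans hp1).ne'
  have hr : 0 < p.toReal := ENNReal.toReal_pos hp0 hp
  rw [Lp.norm_def, (Lp.memLp u).eLpNorm_eq_integral_rpow_norm hp0 hp,
    ENNReal.toReal_ofReal (by positivity), ← Real.rpow_mul (by positivity),
    inv_mul_cancel₀ hr.ne', Real.rpow_one]
  rfl

theorem Lp_uniform_convexity [Fact (1 ≤ p)] (hp1 : 1 < p) (hp : p ≠ ∞) {ε : ℝ} (hε : 0 < ε) :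
    ∃ C : ℝ, 0 ≤ C ∧ ∀ u v : Lp ℝ p m, 0 ≤ u → 0 ≤ v →
      ‖u - v‖ ^ p.toReal ≤ ε * (‖u‖ ^ p.toReal + ‖v‖ ^ p.toReal) +
        C * ((‖u‖ ^ p.toReal + ‖v‖ ^ p.toReal) / 2 - ‖(2⁻¹ : ℝ) • (u + v)‖ ^ p.toReal) := by
  have hp0 : p ≠ 0 := (zero_lt_one.trans hp1).ne'
  have hr : 1 < p.toReal := by
    rw [← ENNReal.toReal_one]; exact (ENNReal.toReal_lt_toReal (by simp) hp).2 hp1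
  obtain ⟨C, hC, H⟩ := rpow_uniform_convexity hr hε
  refine ⟨C, hC, fun u v hu hv => ?_⟩
  have hi : ∀ w : Lp ℝ p m, Integrable (fun x => |w x| ^ p.toReal) m :=
    fun w => (Lp.memLp w).integrable_norm_rpow hp0 hp
  simp only [Lp_norm_rpow_eq_integral hp1 hp]
  have i1 : Integrable (fun x => |u x| ^ p.toReal + |v x| ^ p.toReal) m := (hi u).add (hi v)
  have i2 : Integrable (fun x => (|u x| ^ p.toReal + |v x| ^ p.toReal) / 2) m := i1.div_const 2
  have i3 : Integrable (fun x => (|u x| ^ p.toReal + |v x| ^ p.toReal) / 2 -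
      |((2⁻¹ : ℝ) • (u + v) : Lp ℝ p m) x| ^ p.toReal) m := i2.sub (hi _)
  have i4 := i1.const_mul ε
  have i5 := i3.const_mul C
  rw [← integral_add (hi u) (hi v), ← integral_const_mul, ← integral_div,
    ← integral_sub i2 (hi _), ← integral_const_mul, ← integral_add i4 i5]
  refine integral_mono_ae (hi _) (i4.add i5) ?_
  have hu' := (Lp.coeFn_nonneg u).2 hu
  have hv' := (Lp.coeFn_nonneg v).2 hv
  filter_upwards [hu', hv', Lp.coeFn_sub u v, Lp.coeFn_smul (2⁻¹ : ℝ) (u + v),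
    Lp.coeFn_add u v] with x h1 h2 h3 h4 h5
  simp only [Pi.zero_apply] at h1 h2
  have := H (u x) (v x) h1 h2
  simp only [h3, h4, h5, Pi.sub_apply, Pi.smul_apply, Pi.add_apply, smul_eq_mul, abs_of_nonneg h1,
    abs_of_nonneg h2]
  have h6 : |2⁻¹ * (u x + v x)| = (u x + v x) / 2 := by
    rw [abs_of_nonneg (mul_nonneg (by norm_num) (add_nonneg h1 h2))]; ring
  rw [h6]
  exact this

theorem Lp_cauchySeq_of_midpoint [Fact (1 ≤ p)] (hp1 : 1 < p) (hp : p ≠ ∞) {u : ℕ → Lp ℝ p m}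
    (hu : ∀ n, 0 ≤ u n) {c : ℝ} (hc : Tendsto (fun n => ‖u n‖) atTop (𝓝 c)) {b : ℕ → ℝ}
    (hb0 : ∀ n, 0 ≤ b n) (hb : Tendsto b atTop (𝓝 c))
    (hmid : ∀ n k, n ≤ k → b n ≤ ‖(2⁻¹ : ℝ) • (u n + u k)‖) : CauchySeq u := by
  have hp0 : p ≠ 0 := (zero_lt_one.trans hp1).ne'
  have hr : 0 < p.toReal := ENNReal.toReal_pos hp0 hp
  set r := p.toReal
  have hc0 : 0 ≤ c := ge_of_tendsto' hb hb0
  have hcr : Tendsto (fun n => ‖u n‖ ^ r) atTop (𝓝 (c ^ r)) :=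
    hc.rpow_const (Or.inr hr.le)
  have hbr : Tendsto (fun n => b n ^ r) atTop (𝓝 (c ^ r)) := hb.rpow_const (Or.inr hr.le)
  rw [Metric.cauchySeq_iff']
  intro δ hδ
  have hδr : 0 < δ ^ r := Real.rpow_pos_of_pos hδ r
  set ε := δ ^ r / (4 * (c ^ r + 1)) with hεd
  have hcr0 : 0 ≤ c ^ r := Real.rpow_nonneg hc0 r
  have hε : 0 < ε := by positivity
  obtain ⟨C, hC, H⟩ := Lp_uniform_convexity (m := m) hp1 hp hε
  set η := min 1 (δ ^ r / (4 * (C + 1))) with hη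
  have hη0 : 0 < η := by positivity
  have e1 : ∀ᶠ n in atTop, ‖u n‖ ^ r < c ^ r + η := hcr.eventually_lt_const (by linarith)
  have e2 : ∀ᶠ n in atTop, c ^ r - η < b n ^ r := hbr.eventually_const_lt (by linarith)
  obtain ⟨N, hN⟩ := eventually_atTop.1 (e1.and e2)
  refine ⟨N, fun n hn => ?_⟩
  have hub := H (u n) (u N) (hu n) (hu N)
  have h1 := (hN n hn).1
  have h2 := (hN N le_rfl).1
  have h3 := (hN N le_rfl).2
  have h4 : b N ^ r ≤ ‖(2⁻¹ : ℝ) • (u n + u N)‖ ^ r := by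
    rw [add_comm]; exact Real.rpow_le_rpow (hb0 N) (hmid N n hn) hr.le
  have hη1 : η ≤ 1 := min_le_left _ _
  have hη2 : η * (4 * (C + 1)) ≤ δ ^ r := by
    rw [← le_div_iff₀ (by positivity)]; exact min_le_right _ _
  have hε2 : ε * (4 * (c ^ r + 1)) = δ ^ r := by rw [hεd]; field_simp
  have h5 : ε * (‖u n‖ ^ r + ‖u N‖ ^ r) ≤ ε * (2 * (c ^ r + 1)) :=
    mul_le_mul_of_nonneg_left (by linarith) hε.le
  have h6 : C * ((‖u n‖ ^ r + ‖u N‖ ^ r) / 2 - ‖(2⁻¹ : ℝ) • (u n + u N)‖ ^ r) ≤ C * (2 * η) :=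
    mul_le_mul_of_nonneg_left (by linarith) hC
  have h7 : ‖u n - u N‖ ^ r < δ ^ r := by nlinarith
  rw [dist_eq_norm]
  exact lt_of_not_ge fun hge => absurd (Real.rpow_le_rpow hδ.le hge hr.le) (not_le.2 h7)

theorem Lp_smul_le {u v : Lp ℝ p m} {a : ℝ} (ha : 0 ≤ a) (huv : u ≤ v) : a • u ≤ a • v := by
  rw [← Lp.coeFn_le] at huv ⊢
  filter_upwards [huv, Lp.coeFn_smul a u, Lp.coeFn_smul a v] with z h1 h2 h3
  rw [h2, h3]; exact mul_le_mul_of_nonneg_left h1 ha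

end Lp

/-! ### `L^0` convergence and weak convergence in `L^p` -/

section Conv
variable {M : Type*} [MeasurableSpace M]

/-- Convergence in `L^0(m)`: convergence in measure on every measurable set of finite measure. -/
def TendstoL0 (m : Measure M) (f : ℕ → M →ₘ[m] ℝ) (g : M →ₘ[m] ℝ) : Prop :=
  ∀ E : Set M, MeasurableSet E → m E ≠ ∞ →
    TendstoInMeasure (m.restrict E) (fun n => (f n : M → ℝ)) atTop (g : M → ℝ)

/-- Weak convergence in `L^p(m)`. -/
def WeakTendstoLp {m : Measure M} {p : ℝ≥0∞} [Fact (1 ≤ p)] (u : ℕ → Lp ℝ p m) (G : Lp ℝ p m) :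
    Prop :=
  ∀ φ : StrongDual ℝ (Lp ℝ p m), Tendsto (fun n => φ (u n)) atTop (𝓝 (φ G))

variable {m : Measure M}

theorem tendstoL0_of_ae {f : ℕ → M →ₘ[m] ℝ} {g : M →ₘ[m] ℝ}
    (h : ∀ᵐ x ∂m, Tendsto (fun n => f n x) atTop (𝓝 (g x))) : TendstoL0 m f g := by
  intro E _ hE
  have : IsFiniteMeasure (m.restrict E) := ⟨by simpa using hE.lt_top⟩
  exact tendstoInMeasure_of_tendsto_ae
    (fun n => (f n).aestronglyMeasurable.mono_measure Measure.restrict_le_self)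
    (ae_mono Measure.restrict_le_self h)

theorem TendstoL0.comp {f : ℕ → M →ₘ[m] ℝ} {g : M →ₘ[m] ℝ} (h : TendstoL0 m f g) {ns : ℕ → ℕ}
    (hns : StrictMono ns) : TendstoL0 m (fun n => f (ns n)) g :=
  fun E hE hE' => (h E hE hE').comp hns.tendsto_atTop

theorem TendstoL0.exists_subseq_ae [SigmaFinite m] {f : ℕ → M →ₘ[m] ℝ} {g : M →ₘ[m] ℝ}
    (h : TendstoL0 m f g) :
    ∃ ns : ℕ → ℕ, StrictMono ns ∧ ∀ᵐ x ∂m, Tendsto (fun n => f (ns n) x) atTop (𝓝 (g x)) := by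
  set ν := m.toFinite
  have hνm : ν ≪ m := toFinite_absolutelyContinuous m
  have hmν : m ≪ ν := absolutelyContinuous_toFinite m
  set S := spanningSets m
  have hSm : ∀ k, MeasurableSet (S k) := measurableSet_spanningSets m
  have h1 : ∀ k, TendstoInMeasure (ν.restrict (S k)) (fun n => (f n : M → ℝ)) atTop g := by
    intro k
    have : IsFiniteMeasure (m.restrict (S k)) := ⟨by simpa using measure_spanningSets_lt_top m k⟩
    have hk := h (S k) (hSm k) (measure_spanningSets_lt_top m k).ne
    have ac : ν.restrict (S k) ≪ m.restrict (S k) := hνm.restrict (S k)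
    rw [exists_seq_tendstoInMeasure_atTop_iff
      (fun n => ((f n).aestronglyMeasurable.mono_ac hνm).mono_measure Measure.restrict_le_self)]
    intro ns hns
    obtain ⟨ns', h1, h2⟩ := (hk.comp hns.tendsto_atTop).exists_seq_tendsto_ae
    exact ⟨ns', h1, ac.ae_le h2⟩
  have h2 : TendstoInMeasure ν (fun n => (f n : M → ℝ)) atTop g := by
    intro ε hε
    have hlim : Tendsto (fun k => ν (S k)ᶜ) atTop (𝓝 0) := by
      have : Tendsto (fun k => ν (S k)ᶜ) atTop (𝓝 (ν (⋂ k, (S k)ᶜ))) := by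
        refine tendsto_measure_iInter_atTop (fun k => (hSm k).compl.nullMeasurableSet) ?_
          ⟨0, measure_ne_top _ _⟩
        exact fun i j hij => compl_subset_compl.2 (monotone_spanningSets m hij)
      rwa [← compl_iUnion, iUnion_spanningSets, compl_univ, measure_empty] at this
    rw [ENNReal.tendsto_nhds_zero]
    intro δ hδ
    obtain ⟨k, hk⟩ := ((ENNReal.tendsto_nhds_zero.1 hlim) (δ / 2) (ENNReal.half_pos hδ.ne')).exists
    filter_upwards [(ENNReal.tendsto_nhds_zero.1 (h1 k ε hε)) (δ / 2)
      (ENNReal.half_pos hδ.ne')] with n hn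
    rw [Measure.restrict_apply' (hSm k)] at hn
    calc _ ≤ ν (({x | ε ≤ edist (f n x) (g x)} ∩ S k) ∪ (S k)ᶜ) := by
            refine measure_mono fun x hx => ?_
            by_cases hxk : x ∈ S k
            · exact Or.inl ⟨hx, hxk⟩
            · exact Or.inr hxk
      _ ≤ _ := measure_union_le _ _
      _ ≤ δ / 2 + δ / 2 := add_le_add hn hk
      _ = δ := ENNReal.add_halves δ
  obtain ⟨ns, hns, hae⟩ := h2.exists_seq_tendsto_ae
  exact ⟨ns, hns, hmν.ae_le hae⟩

end Conv

/-! ### `L^p`-valued functionals -/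

/-- An `L^p(m)`-valued, nonnegative, subadditive and absolutely homogeneous functional
`f ↦ g_f` on a vector space `V` of functions; `toL0` sends a function to its class in `L^0(m)`. -/
structure LpFunctional {M : Type*} [MeasurableSpace M] (m : Measure M) (p : ℝ≥0∞) [Fact (1 ≤ p)]
    (V : Type*) [AddCommGroup V] [Module ℝ V] where
  toL0 : V →ₗ[ℝ] (M →ₘ[m] ℝ)
  g : V → Lp ℝ p m
  g_nonneg : ∀ f, 0 ≤ g f
  g_add_le : ∀ f h, g (f + h) ≤ g f + g h
  g_smul : ∀ (c : ℝ) f, g (c • f) = |c| • g f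

namespace LpFunctional

section Relax
variable {M : Type*} [MeasurableSpace M] {m : Measure M} {p : ℝ≥0∞} [Fact (1 ≤ p)]
  {V : Type*} [AddCommGroup V] [Module ℝ V] (F : LpFunctional m p V)

/-- `u n → f` in `L^0(m)`, for a sequence `u` in the domain of the functional. -/
def ConvergesTo (u : ℕ → V) (f : M →ₘ[m] ℝ) : Prop :=
  TendstoL0 m (fun n => F.toL0 (u n)) f

/-- The lower semicontinuous hull of `f ↦ ∫ g_f ^ p`. -/
noncomputable def hullEnergy (f : M →ₘ[m] ℝ) : ℝ≥0∞ :=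
  ⨅ (u : ℕ → V) (_ : F.ConvergesTo u f),
    liminf (fun n => ∫⁻ x, ‖F.g (u n) x‖ₑ ^ p.toReal ∂m) atTop

/-- Upper relaxations at `f`. -/
def IsUpperRelaxation (f : M →ₘ[m] ℝ) (G : Lp ℝ p m) : Prop :=
  ∃ (u : ℕ → V) (G' : Lp ℝ p m), F.ConvergesTo u f ∧ WeakTendstoLp (fun n => F.g (u n)) G' ∧ G' ≤ G

/-- Strong upper relaxations at `f`: upper relaxations `G` for which some sequence `u n → f`
has `g_{h n} → G` strongly whenever each `h n` is a finite convex combination of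
`{u k | n ≤ k}`. -/
def IsStrongUpperRelaxation (f : M →ₘ[m] ℝ) (G : Lp ℝ p m) : Prop :=
  F.IsUpperRelaxation f G ∧ ∃ u : ℕ → V, F.ConvergesTo u f ∧
    ∀ h : ℕ → V, (∀ n, h n ∈ convexHull ℝ (u '' Ici n)) →
      Tendsto (fun n => F.g (h n)) atTop (𝓝 G)

/-- The set of all `G` lying below every weak limit of `g_{u n}`, `u n → f`. -/
def lowerSet (f : M →ₘ[m] ℝ) : Set (Lp ℝ p m) :=
  {G | ∀ (u : ℕ → V) (G' : Lp ℝ p m), F.ConvergesTo u f →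
    WeakTendstoLp (fun n => F.g (u n)) G' → G ≤ G'}

open Classical in
/-- The lower relaxation at `f`: the greatest element of `lowerSet f`
(it exists for `hullEnergy f < ∞`, see `isGreatest_lowerRelax`). -/
noncomputable def lowerRelax (f : M →ₘ[m] ℝ) : Lp ℝ p m :=
  if h : ∃ G, IsGreatest (F.lowerSet f) G then h.choose else 0

end Relax

end LpFunctional

namespace LpFunctional

section RelaxLemmas
variable {M : Type*} [MeasurableSpace M] {m : Measure M} {p : ℝ≥0∞} [Fact (1 ≤ p)]
  {V : Type*} [AddCommGroup V] [Module ℝ V] (F : LpFunctional m p V)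

theorem g_zero : F.g 0 = 0 := by
  have := F.g_smul 0 0
  simpa using this

theorem convexHull_toL0 {u : ℕ → V} {s : Set ℕ} {w : V} (hw : w ∈ convexHull ℝ (u '' s)) :
    ∀ᵐ x ∂m, F.toL0 w x ∈ convexHull ℝ ((fun k => F.toL0 (u k) x) '' s) := by
  revert w
  suffices convexHull ℝ (u '' s) ⊆
      {w | ∀ᵐ x ∂m, F.toL0 w x ∈ convexHull ℝ ((fun k => F.toL0 (u k) x) '' s)} from
    fun w hw => this hw
  refine convexHull_min ?_ ?_
  · rintro _ ⟨k, hk, rfl⟩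
    exact ae_of_all m fun x =>
      subset_convexHull ℝ _ (mem_image_of_mem (fun k => F.toL0 (u k) x) hk)
  · intro w1 h1 w2 h2 a b ha hb hab
    change ∀ᵐ x ∂m, _
    rw [map_add, map_smul, map_smul]
    filter_upwards [h1, h2, AEEqFun.coeFn_add (a • F.toL0 w1) (b • F.toL0 w2),
      AEEqFun.coeFn_smul a (F.toL0 w1), AEEqFun.coeFn_smul b (F.toL0 w2)] with x e1 e2 e3 e4 e5
    rw [e3, Pi.add_apply, e4, e5]
    exact convex_convexHull ℝ _ e1 e2 ha hb hab

/-- Convex combinations of tails of an a.e. convergent sequence converge a.e. -/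
theorem ae_tendsto_of_convexHull {u : ℕ → V} {f : M →ₘ[m] ℝ}
    (hu : ∀ᵐ x ∂m, Tendsto (fun n => F.toL0 (u n) x) atTop (𝓝 (f x))) {h : ℕ → V}
    (hh : ∀ n, h n ∈ convexHull ℝ (u '' Ici n)) :
    ∀ᵐ x ∂m, Tendsto (fun n => F.toL0 (h n) x) atTop (𝓝 (f x)) := by
  have := ae_all_iff.2 fun n => F.convexHull_toL0 (hh n)
  filter_upwards [hu, this] with x h1 h2
  rw [Metric.tendsto_atTop'] at h1
  refine Metric.tendsto_atTop'.2 fun ε hε => ?_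
  obtain ⟨N, hN⟩ := h1 ε hε
  refine ⟨N, fun n hn => ?_⟩
  have : convexHull ℝ ((fun k => F.toL0 (u k) x) '' Ici n) ⊆ Metric.ball (f x) ε := by
    refine convexHull_min ?_ (convex_ball _ _)
    rintro _ ⟨k, hk, rfl⟩
    exact hN k (lt_of_lt_of_le hn hk)
  exact this (h2 n)

theorem exists_strong_convex (hp1 : 1 < p) (hp : p ≠ ∞) {u : ℕ → V} {C : ℝ}
    (hC : ∀ n, ‖F.g (u n)‖ ≤ C) :
    ∃ (h : ℕ → V) (G : Lp ℝ p m), (∀ n, h n ∈ convexHull ℝ (u '' Ici n)) ∧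
      Tendsto (fun n => F.g (h n)) atTop (𝓝 G) := by
  set S : ℕ → Set ℝ := fun n => (fun w => ‖F.g w‖) '' convexHull ℝ (u '' Ici n) with hS
  set b : ℕ → ℝ := fun n => sInf (S n) with hb
  have hbdd : ∀ n, BddBelow (S n) := fun n => ⟨0, by rintro _ ⟨w, -, rfl⟩; positivity⟩
  have hne : ∀ n, (S n).Nonempty := fun n =>
    ⟨_, u n, subset_convexHull ℝ _ ⟨n, self_mem_Ici, rfl⟩, rfl⟩
  have hb0 : ∀ n, 0 ≤ b n := fun n =>
    le_csInf (hne n) (by rintro _ ⟨w, -, rfl⟩; positivity)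
  have hbC : ∀ n, b n ≤ C := fun n =>
    (csInf_le (hbdd n) ⟨u n, subset_convexHull ℝ _ ⟨n, self_mem_Ici, rfl⟩, rfl⟩).trans (hC n)
  have hanti : ∀ n k, n ≤ k → convexHull ℝ (u '' Ici k) ⊆ convexHull ℝ (u '' Ici n) :=
    fun n k hnk => convexHull_mono (image_mono (Ici_subset_Ici.2 hnk))
  have hmono : Monotone b := fun n k hnk =>
    csInf_le_csInf (hbdd n) (hne k) (image_mono (hanti n k hnk))
  have hlim : Tendsto b atTop (𝓝 (⨆ n, b n)) :=
    tendsto_atTop_ciSup hmono ⟨C, by rintro _ ⟨n, rfl⟩; exact hbC n⟩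
  have hex : ∀ n : ℕ, ∃ w ∈ convexHull ℝ (u '' Ici n), ‖F.g w‖ < b n + 1 / ((n : ℝ) + 1) := by
    intro n
    have hpos : (0 : ℝ) < 1 / ((n : ℝ) + 1) := by positivity
    obtain ⟨_, ⟨w, hw, rfl⟩, hlt⟩ := exists_lt_of_csInf_lt (hne n)
      (show sInf (S n) < b n + 1 / ((n : ℝ) + 1) by linarith)
    exact ⟨w, hw, hlt⟩
  choose h hh hlt using hex
  have hge : ∀ n w, w ∈ convexHull ℝ (u '' Ici n) → b n ≤ ‖F.g w‖ :=
    fun n w hw => csInf_le (hbdd n) ⟨w, hw, rfl⟩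
  have hnorm : Tendsto (fun n => ‖F.g (h n)‖) atTop (𝓝 (⨆ n, b n)) := by
    refine tendsto_of_tendsto_of_tendsto_of_le_of_le hlim
      (h := fun n : ℕ => b n + 1 / ((n : ℝ) + 1)) ?_ (fun n => hge n _ (hh n))
      (fun n => (hlt n).le)
    simpa using hlim.add tendsto_one_div_add_atTop_nhds_zero_nat
  have hcau : CauchySeq fun n => F.g (h n) := by
    refine Lp_cauchySeq_of_midpoint hp1 hp (fun n => F.g_nonneg _) hnorm hb0 hlim ?_
    intro n k hnk
    have hmem : (2⁻¹ : ℝ) • (h n + h k) ∈ convexHull ℝ (u '' Ici n) := by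
      rw [smul_add]
      exact convex_convexHull ℝ _ (hh n) (hanti n k hnk (hh k)) (by norm_num) (by norm_num)
        (by norm_num)
    refine (hge n _ hmem).trans ?_
    have h0 : 0 ≤ F.g ((2⁻¹ : ℝ) • (h n + h k)) := F.g_nonneg _
    have h1 : F.g ((2⁻¹ : ℝ) • (h n + h k)) ≤ (2⁻¹ : ℝ) • (F.g (h n) + F.g (h k)) := by
      have e2 : |(2⁻¹ : ℝ)| = 2⁻¹ := by norm_num
      rw [smul_add, smul_add]
      refine (F.g_add_le _ _).trans (le_of_eq ?_)
      rw [F.g_smul, F.g_smul, e2]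
    refine norm_le_norm_of_abs_le_abs ?_
    rw [abs_of_nonneg h0, abs_of_nonneg (h0.trans h1)]
    exact h1
  obtain ⟨G, hG⟩ := cauchySeq_tendsto_of_complete hcau
  exact ⟨h, G, hh, hG⟩

theorem lintegral_g (hp1 : 1 < p) (hp : p ≠ ∞) (f : V) :
    ∫⁻ x, ‖F.g f x‖ₑ ^ p.toReal ∂m = ‖F.g f‖ₑ ^ p.toReal := by
  have hp0 : p ≠ 0 := (zero_lt_one.trans hp1).ne'
  have hr : 0 < p.toReal := ENNReal.toReal_pos hp0 hp
  rw [Lp.enorm_def, eLpNorm_eq_lintegral_rpow_enorm_toReal hp0 hp, ← ENNReal.rpow_mul,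
    one_div_mul_cancel hr.ne', ENNReal.rpow_one]

theorem hullEnergy_lt_top_iff [SigmaFinite m] (hp1 : 1 < p) (hp : p ≠ ∞) {f : M →ₘ[m] ℝ} :
    F.hullEnergy f < ∞ ↔ ∃ (u : ℕ → V) (C : ℝ),
      (∀ᵐ x ∂m, Tendsto (fun n => F.toL0 (u n) x) atTop (𝓝 (f x))) ∧ ∀ n, ‖F.g (u n)‖ ≤ C := by
  have hp0 : p ≠ 0 := (zero_lt_one.trans hp1).ne'
  have hr : 0 < p.toReal := ENNReal.toReal_pos hp0 hp
  constructor
  · intro h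
    obtain ⟨u, hu⟩ := iInf_lt_iff.1 h
    obtain ⟨hconv, hlim⟩ := iInf_lt_iff.1 hu
    obtain ⟨c, hc1, hc2⟩ := exists_between hlim
    have hfr := frequently_lt_of_liminf_lt (by isBoundedDefault) hc1
    obtain ⟨ns, hns, hlt⟩ := extraction_of_frequently_atTop hfr
    obtain ⟨ks, hks, hae⟩ := (hconv.comp hns).exists_subseq_ae
    refine ⟨fun n => u (ns (ks n)), (c ^ (p.toReal)⁻¹).toReal, hae, fun n => ?_⟩
    have h1 := hlt (ks n)
    rw [F.lintegral_g hp1 hp] at h1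
    have h2 : ‖F.g (u (ns (ks n)))‖ₑ ≤ c ^ (p.toReal)⁻¹ := by
      rw [ENNReal.le_rpow_inv_iff hr]; exact h1.le
    rw [← toReal_enorm]
    exact ENNReal.toReal_mono (ENNReal.rpow_ne_top_of_nonneg (by positivity) hc2.ne) h2
  · rintro ⟨u, C, hae, hC⟩
    refine lt_of_le_of_lt (iInf₂_le u (tendstoL0_of_ae hae)) ?_
    have : ∀ n, ∫⁻ x, ‖F.g (u n) x‖ₑ ^ p.toReal ∂m ≤ ENNReal.ofReal C ^ p.toReal := by
      intro n
      rw [F.lintegral_g hp1 hp]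
      refine ENNReal.rpow_le_rpow ?_ hr.le
      rw [← ofReal_norm]
      exact ENNReal.ofReal_le_ofReal (hC n)
    refine lt_of_le_of_lt (liminf_le_of_frequently_le' (Frequently.of_forall this)) ?_
    exact ENNReal.rpow_lt_top_of_nonneg hr.le ENNReal.ofReal_ne_top

theorem weak_of_strong {u : ℕ → Lp ℝ p m} {G : Lp ℝ p m} (h : Tendsto u atTop (𝓝 G)) :
    WeakTendstoLp u G := fun φ => (φ.continuous.tendsto G).comp h

theorem weak_bounded {u : ℕ → Lp ℝ p m} {G : Lp ℝ p m} (h : WeakTendstoLp u G) :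
    ∃ C, ∀ n, ‖u n‖ ≤ C := by
  have := banach_steinhaus (g := fun n => NormedSpace.inclusionInDoubleDual ℝ (Lp ℝ p m) (u n))
    (fun φ => by
      obtain ⟨C, hC⟩ := (h φ).norm.bddAbove_range
      exact ⟨C, fun n => hC ⟨n, rfl⟩⟩)
  obtain ⟨C, hC⟩ := this
  refine ⟨C, fun n => ?_⟩
  have e := (NormedSpace.inclusionInDoubleDualLi ℝ (E := Lp ℝ p m)).norm_map (u n)
  rw [← e]; exact hC n

theorem weak_nonneg {u : ℕ → Lp ℝ p m} {G : Lp ℝ p m} (h : WeakTendstoLp u G)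
    (hu : ∀ n, 0 ≤ u n) : 0 ≤ G := by
  by_contra hG
  have hconv : Convex ℝ (Ici (0 : Lp ℝ p m)) := by
    intro x hx y hy a b ha hb _
    have h1 : 0 ≤ a • x := by
      rw [mem_Ici, ← Lp.coeFn_nonneg] at hx
      rw [← Lp.coeFn_nonneg]
      filter_upwards [hx, Lp.coeFn_smul a x] with z h1 h2
      rw [h2]; exact mul_nonneg ha h1
    have h2 : 0 ≤ b • y := by
      rw [mem_Ici, ← Lp.coeFn_nonneg] at hy
      rw [← Lp.coeFn_nonneg]
      filter_upwards [hy, Lp.coeFn_smul b y] with z h1 h2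
      rw [h2]; exact mul_nonneg hb h1
    exact add_nonneg h1 h2
  obtain ⟨φ, s, h1, h2⟩ := geometric_hahn_banach_closed_point hconv isClosed_Ici hG
  have := le_of_tendsto' (h φ) (fun n => (h1 (u n) (hu n)).le)
  linarith

end RelaxLemmas

end LpFunctional

namespace LpFunctional

section RelaxFunctional
variable {M : Type*} [MeasurableSpace M] {m : Measure M} {p : ℝ≥0∞} [Fact (1 ≤ p)]
  {V : Type*} [AddCommGroup V] [Module ℝ V] (F : LpFunctional m p V)

theorem Lp_norm_mono {u v : Lp ℝ p m} (hu : 0 ≤ u) (huv : u ≤ v) : ‖u‖ ≤ ‖v‖ := by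
  refine norm_le_norm_of_abs_le_abs ?_
  rwa [abs_of_nonneg hu, abs_of_nonneg (hu.trans huv)]

theorem weak_convexHull {v W : ℕ → Lp ℝ p m} {G : Lp ℝ p m} (h : WeakTendstoLp v G)
    (hW : ∀ n, W n ∈ convexHull ℝ (v '' Ici n)) : WeakTendstoLp W G := by
  intro φ
  have h1 := Metric.tendsto_atTop'.1 (h φ)
  refine Metric.tendsto_atTop'.2 fun ε hε => ?_
  obtain ⟨N, hN⟩ := h1 ε hε
  refine ⟨N, fun n hn => ?_⟩
  have : convexHull ℝ (v '' Ici n) ⊆ φ ⁻¹' Metric.ball (φ G) ε := by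
    refine convexHull_min ?_ ((convex_ball _ _).linear_preimage φ.toLinearMap)
    rintro _ ⟨k, hk, rfl⟩
    exact hN k (lt_of_lt_of_le hn hk)
  exact this (hW n)

theorem weak_le {u v : ℕ → Lp ℝ p m} {G G' : Lp ℝ p m} (hu : WeakTendstoLp u G)
    (hv : WeakTendstoLp v G') (huv : ∀ n, u n ≤ v n) : G ≤ G' := by
  have : WeakTendstoLp (fun n => v n - u n) (G' - G) := by
    intro φ; simpa using (hv φ).sub (hu φ)
  exact sub_nonneg.1 (weak_nonneg this fun n => sub_nonneg.2 (huv n))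

theorem exists_strong_upper [SigmaFinite m] (hp1 : 1 < p) (hp : p ≠ ∞) {f : M →ₘ[m] ℝ}
    (hf : F.hullEnergy f < ∞) : ∃ (u : ℕ → V) (G : Lp ℝ p m), F.ConvergesTo u f ∧
      Tendsto (fun n => F.g (u n)) atTop (𝓝 G) := by
  obtain ⟨u, C, hae, hC⟩ := (F.hullEnergy_lt_top_iff hp1 hp).1 hf
  obtain ⟨h, G, hh, hG⟩ := F.exists_strong_convex hp1 hp hC
  exact ⟨h, G, tendstoL0_of_ae (F.ae_tendsto_of_convexHull hae hh), hG⟩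

theorem zero_mem_lowerSet (f : M →ₘ[m] ℝ) : 0 ∈ F.lowerSet f :=
  fun _ _ _ hG' => weak_nonneg hG' fun _ => F.g_nonneg _

theorem exists_isGreatest_lowerSet [SigmaFinite m] (hp1 : 1 < p) (hp : p ≠ ∞) {f : M →ₘ[m] ℝ}
    (hf : F.hullEnergy f < ∞) : ∃ G, IsGreatest (F.lowerSet f) G := by
  have hp0 : p ≠ 0 := (zero_lt_one.trans hp1).ne'
  have hr : 0 < p.toReal := ENNReal.toReal_pos hp0 hp
  obtain ⟨u, B, hu, hB⟩ := F.exists_strong_upper hp1 hp hf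
  have hle : ∀ G ∈ F.lowerSet f, G ≤ B := fun G hG => hG u B hu (weak_of_strong hB)
  have hsup : ∀ G ∈ F.lowerSet f, ∀ G' ∈ F.lowerSet f, G ⊔ G' ∈ F.lowerSet f :=
    fun G hG G' hG' w K hw hK => sup_le (hG w K hw hK) (hG' w K hw hK)
  set S : Set ℝ := norm '' {G | G ∈ F.lowerSet f ∧ 0 ≤ G} with hS
  have hSb : ∀ y ∈ S, y ≤ ‖B‖ := by
    rintro _ ⟨G, ⟨hG, hG0⟩, rfl⟩; exact Lp_norm_mono hG0 (hle G hG)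
  have hSbdd : BddAbove S := ⟨‖B‖, hSb⟩
  have hSne : S.Nonempty := ⟨‖(0 : Lp ℝ p m)‖, 0, ⟨F.zero_mem_lowerSet f, le_rfl⟩, rfl⟩
  set c := sSup S with hc
  have hex : ∀ n : ℕ, ∃ G : Lp ℝ p m, (G ∈ F.lowerSet f ∧ 0 ≤ G) ∧
      c - 1 / ((n : ℝ) + 1) < ‖G‖ := by
    intro n
    have hpos : (0 : ℝ) < 1 / ((n : ℝ) + 1) := by positivity
    obtain ⟨_, ⟨w, hw, rfl⟩, hlt⟩ := exists_lt_of_lt_csSup hSne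
      (show c - 1 / ((n : ℝ) + 1) < sSup S by rw [← hc]; linarith)
    exact ⟨w, hw, hlt⟩
  choose K hK hKlt using hex
  set P : ℕ → Lp ℝ p m := fun n => partialSups K n with hP
  have hPmem : ∀ n, P n ∈ F.lowerSet f := by
    intro n
    induction n with
    | zero => simpa [hP] using (hK 0).1
    | succ n ih =>
      have : P (n + 1) = P n ⊔ K (n + 1) := by simp [hP, partialSups_add_one]
      rw [this]; exact hsup _ ih _ (hK _).1
  have hKP : ∀ n, K n ≤ P n := fun n => le_partialSups K n
  have hP0 : ∀ n, 0 ≤ P n := fun n => (hK n).2.trans (hKP n)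
  have hPmono : Monotone P := (partialSups K).monotone
  have hPc : ∀ n, ‖P n‖ ≤ c := fun n => le_csSup hSbdd ⟨P n, ⟨hPmem n, hP0 n⟩, rfl⟩
  have hPlim : Tendsto (fun n => ‖P n‖) atTop (𝓝 c) := by
    refine tendsto_of_tendsto_of_tendsto_of_le_of_le
      (g := fun n : ℕ => c - 1 / ((n : ℝ) + 1)) ?_ tendsto_const_nhds
      (fun n => (hKlt n).le.trans (Lp_norm_mono (hK n).2 (hKP n))) hPc
    simpa using (tendsto_const_nhds (x := c)).sub
      (tendsto_one_div_add_atTop_nhds_zero_nat (𝕜 := ℝ))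
  have hcau : CauchySeq P := by
    refine Lp_cauchySeq_of_midpoint hp1 hp hP0 hPlim (b := fun n => ‖P n‖)
      (fun n => norm_nonneg _) hPlim fun n k hnk => Lp_norm_mono (hP0 n) ?_
    have h1 : P n = (2⁻¹ : ℝ) • (P n + P n) := by
      rw [← two_smul ℝ (P n), smul_smul]; norm_num
    conv_lhs => rw [h1]
    exact Lp_smul_le (by norm_num) (add_le_add_right (hPmono hnk) (P n))
  obtain ⟨G, hG⟩ := cauchySeq_tendsto_of_complete hcau
  have hPG : ∀ n, P n ≤ G := fun n => hPmono.ge_of_tendsto hG n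
  have hG0 : 0 ≤ G := (hP0 0).trans (hPG 0)
  have hGmem : G ∈ F.lowerSet f := fun w W hw hW =>
    le_of_tendsto' hG fun n => hPmem n w W hw hW
  have hGc : ‖G‖ = c := tendsto_nhds_unique hG.norm hPlim
  refine ⟨G, hGmem, fun G' hG' => ?_⟩
  set L := G ⊔ G' with hL
  have hGL : G ≤ L := le_sup_left
  have hL0 : 0 ≤ L := hG0.trans hGL
  have hLc : ‖L‖ = c := le_antisymm (le_csSup hSbdd ⟨L, ⟨hsup _ hGmem _ hG', hL0⟩, rfl⟩)
    (hGc ▸ Lp_norm_mono hG0 hGL)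
  have hmid : c ≤ ‖(2⁻¹ : ℝ) • (L + G)‖ := by
    rw [← hGc]
    refine Lp_norm_mono hG0 ?_
    have h1 : G = (2⁻¹ : ℝ) • (G + G) := by
      rw [← two_smul ℝ G, smul_smul]; norm_num
    conv_lhs => rw [h1]
    exact Lp_smul_le (by norm_num) (add_le_add_left hGL G)
  have hc0 : 0 ≤ c := hGc ▸ norm_nonneg G
  have hLG : ‖L - G‖ = 0 := by
    by_contra hne
    have hpos : 0 < ‖L - G‖ := lt_of_le_of_ne (norm_nonneg _) (Ne.symm hne)
    have hposr : 0 < ‖L - G‖ ^ p.toReal := Real.rpow_pos_of_pos hpos _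
    have hcr : 0 ≤ c ^ p.toReal := Real.rpow_nonneg hc0 _
    have hε : 0 < ‖L - G‖ ^ p.toReal / (4 * (c ^ p.toReal + 1)) := by positivity
    obtain ⟨C, hC, H⟩ := Lp_uniform_convexity (m := m) hp1 hp hε
    have h1 := H L G hL0 hG0
    rw [hLc, hGc] at h1
    have h2 : c ^ p.toReal ≤ ‖(2⁻¹ : ℝ) • (L + G)‖ ^ p.toReal :=
      Real.rpow_le_rpow hc0 hmid hr.le
    have h3 : C * ((c ^ p.toReal + c ^ p.toReal) / 2 - ‖(2⁻¹ : ℝ) • (L + G)‖ ^ p.toReal) ≤ 0 :=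
      mul_nonpos_of_nonneg_of_nonpos hC (by linarith)
    have h4 : ‖L - G‖ ^ p.toReal / (4 * (c ^ p.toReal + 1)) * (4 * (c ^ p.toReal + 1))
        = ‖L - G‖ ^ p.toReal := by field_simp
    nlinarith
  have : L = G := sub_eq_zero.1 (norm_eq_zero.1 hLG)
  exact this ▸ le_sup_right

theorem isGreatest_lowerRelax [SigmaFinite m] (hp1 : 1 < p) (hp : p ≠ ∞) {f : M →ₘ[m] ℝ}
    (hf : F.hullEnergy f < ∞) : IsGreatest (F.lowerSet f) (F.lowerRelax f) := by
  have h := F.exists_isGreatest_lowerSet hp1 hp hf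
  rw [lowerRelax, dif_pos h]
  exact h.choose_spec

theorem exists_upper_add [SigmaFinite m] (hp1 : 1 < p) (hp : p ≠ ∞) {f h : M →ₘ[m] ℝ}
    {u v : ℕ → V} {G1 G2 : Lp ℝ p m} (hu : F.ConvergesTo u f) (hv : F.ConvergesTo v h)
    (hG1 : WeakTendstoLp (fun n => F.g (u n)) G1) (hG2 : WeakTendstoLp (fun n => F.g (v n)) G2) :
    ∃ (w : ℕ → V) (G3 : Lp ℝ p m), F.ConvergesTo w (f + h) ∧
      Tendsto (fun n => F.g (w n)) atTop (𝓝 G3) ∧ G3 ≤ G1 + G2 := by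
  obtain ⟨ns, hns, hae1⟩ := hu.exists_subseq_ae
  obtain ⟨ks, hks, hae2⟩ := (hv.comp hns).exists_subseq_ae
  set u' : ℕ → V := fun n => u (ns (ks n))
  set v' : ℕ → V := fun n => v (ns (ks n))
  have hG1' : WeakTendstoLp (fun n => F.g (u' n)) G1 :=
    fun φ => (hG1 φ).comp (hns.comp hks).tendsto_atTop
  have hG2' : WeakTendstoLp (fun n => F.g (v' n)) G2 :=
    fun φ => (hG2 φ).comp (hns.comp hks).tendsto_atTop
  have hae : ∀ᵐ x ∂m, Tendsto (fun n => F.toL0 (u' n + v' n) x) atTop (𝓝 ((f + h) x)) := by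
    have e : ∀ᵐ x ∂m, ∀ n, (F.toL0 (u' n + v' n)) x = F.toL0 (u' n) x + F.toL0 (v' n) x := by
      refine ae_all_iff.2 fun n => ?_
      rw [map_add]
      exact AEEqFun.coeFn_add _ _
    filter_upwards [hae1, hae2, e, AEEqFun.coeFn_add f h] with x h1 h2 h3 h4
    rw [h4]
    simp only [h3]
    exact (h1.comp hks.tendsto_atTop).add h2
  obtain ⟨C1, hC1⟩ := weak_bounded hG1'
  obtain ⟨C2, hC2⟩ := weak_bounded hG2'
  have hC : ∀ n, ‖F.g (u' n + v' n)‖ ≤ C1 + C2 := fun n =>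
    (Lp_norm_mono (F.g_nonneg _) (F.g_add_le _ _)).trans
      ((norm_add_le _ _).trans (add_le_add (hC1 n) (hC2 n)))
  obtain ⟨w, G3, hw, hG3⟩ := F.exists_strong_convex hp1 hp hC
  refine ⟨w, G3, tendstoL0_of_ae (F.ae_tendsto_of_convexHull hae hw), hG3, ?_⟩
  have hdom : ∀ n, ∃ W ∈ convexHull ℝ ((fun n => F.g (u' n) + F.g (v' n)) '' Ici n),
      F.g (w n) ≤ W := by
    intro n
    refine convexHull_min (t := {w | ∃ W ∈ convexHull ℝ
      ((fun n => F.g (u' n) + F.g (v' n)) '' Ici n), F.g w ≤ W}) ?_ ?_ (hw n)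
    · rintro _ ⟨k, hk, rfl⟩
      exact ⟨_, subset_convexHull ℝ _ (mem_image_of_mem _ hk), F.g_add_le _ _⟩
    · rintro w1 ⟨W1, hW1, h1⟩ w2 ⟨W2, hW2, h2⟩ a b ha hb hab
      refine ⟨a • W1 + b • W2, convex_convexHull ℝ _ hW1 hW2 ha hb hab, ?_⟩
      refine (F.g_add_le _ _).trans ?_
      rw [F.g_smul, F.g_smul, abs_of_nonneg ha, abs_of_nonneg hb]
      exact add_le_add (Lp_smul_le ha h1) (Lp_smul_le hb h2)
  choose W hW hWle using hdom
  have hsum : WeakTendstoLp (fun n => F.g (u' n) + F.g (v' n)) (G1 + G2) := by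
    intro φ; simpa using (hG1' φ).add (hG2' φ)
  exact weak_le (weak_of_strong hG3) (weak_convexHull hsum hW) hWle

/-- The domain of the relaxation: all `f` in `L^0(m)` with finite relaxed energy. -/
def relaxDomain [SigmaFinite m] (hp1 : 1 < p) (hp : p ≠ ∞) : Submodule ℝ (M →ₘ[m] ℝ) where
  carrier := {f | F.hullEnergy f < ∞}
  zero_mem' := by
    refine (F.hullEnergy_lt_top_iff hp1 hp).2 ⟨fun _ => 0, 0, ?_, fun n => by simp [F.g_zero]⟩
    simp
  add_mem' := by
    intro f h hf hh
    obtain ⟨u, G1, hu, hG1⟩ := F.exists_strong_upper hp1 hp hf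
    obtain ⟨v, G2, hv, hG2⟩ := F.exists_strong_upper hp1 hp hh
    obtain ⟨w, G3, hw, hG3, -⟩ := F.exists_upper_add hp1 hp hu hv (weak_of_strong hG1)
      (weak_of_strong hG2)
    obtain ⟨ns, hns, hae⟩ := hw.exists_subseq_ae
    obtain ⟨C, hC⟩ := hG3.norm.bddAbove_range
    exact (F.hullEnergy_lt_top_iff hp1 hp).2 ⟨_, C, hae, fun n => hC ⟨ns n, rfl⟩⟩
  smul_mem' := by
    intro c f hf
    obtain ⟨u, C, hae, hC⟩ := (F.hullEnergy_lt_top_iff hp1 hp).1 hf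
    refine (F.hullEnergy_lt_top_iff hp1 hp).2 ⟨fun n => c • u n, |c| * C, ?_, fun n => ?_⟩
    · have e : ∀ᵐ x ∂m, ∀ n, (F.toL0 (c • u n)) x = c * F.toL0 (u n) x := by
        refine ae_all_iff.2 fun n => ?_
        rw [map_smul]
        exact AEEqFun.coeFn_smul _ _
      filter_upwards [hae, e, AEEqFun.coeFn_smul c f] with x h1 h2 h3
      rw [h3]
      simp only [h2]
      exact h1.const_mul c
    · rw [F.g_smul, norm_smul, Real.norm_eq_abs, abs_abs]
      exact mul_le_mul_of_nonneg_left (hC n) (abs_nonneg c)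

theorem lowerRelax_add_le [SigmaFinite m] (hp1 : 1 < p) (hp : p ≠ ∞) {f h : M →ₘ[m] ℝ}
    (hf : F.hullEnergy f < ∞) (hh : F.hullEnergy h < ∞) :
    F.lowerRelax (f + h) ≤ F.lowerRelax f + F.lowerRelax h := by
  have hfh : F.hullEnergy (f + h) < ∞ := (F.relaxDomain hp1 hp).add_mem hf hh
  have H := (F.isGreatest_lowerRelax hp1 hp hfh).1
  have h1 : ∀ (u : ℕ → V) (G1 : Lp ℝ p m), F.ConvergesTo u f →
      WeakTendstoLp (fun n => F.g (u n)) G1 → F.lowerRelax (f + h) - G1 ≤ F.lowerRelax h := by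
    intro u G1 hu hG1
    refine (F.isGreatest_lowerRelax hp1 hp hh).2 fun v G2 hv hG2 => ?_
    obtain ⟨w, G3, hw, hG3, hle⟩ := F.exists_upper_add hp1 hp hu hv hG1 hG2
    exact sub_le_iff_le_add'.2 ((H w G3 hw (weak_of_strong hG3)).trans hle)
  have h2 : F.lowerRelax (f + h) - F.lowerRelax h ≤ F.lowerRelax f := by
    refine (F.isGreatest_lowerRelax hp1 hp hf).2 fun u G1 hu hG1 => ?_
    exact sub_le_comm.1 (h1 u G1 hu hG1)
  exact sub_le_iff_le_add.1 h2

theorem lowerRelax_zero [SigmaFinite m] (hp1 : 1 < p) (hp : p ≠ ∞) : F.lowerRelax 0 = 0 := by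
  have h0 : F.hullEnergy 0 < ∞ := (F.relaxDomain hp1 hp).zero_mem
  refine le_antisymm ?_ ((F.isGreatest_lowerRelax hp1 hp h0).2 (F.zero_mem_lowerSet 0))
  refine (F.isGreatest_lowerRelax hp1 hp h0).1 (fun _ => 0) 0 ?_ ?_
  · exact tendstoL0_of_ae (by simp)
  · intro φ; simp [F.g_zero]

theorem smul_mem_lowerSet {c : ℝ} (hc : c ≠ 0) {f : M →ₘ[m] ℝ} {G : Lp ℝ p m}
    [SigmaFinite m] (hG : G ∈ F.lowerSet f) : |c| • G ∈ F.lowerSet (c • f) := by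
  intro u G' hu hG'
  obtain ⟨ns, hns, hae⟩ := hu.exists_subseq_ae
  have hconv : F.ConvergesTo (fun n => c⁻¹ • u (ns n)) f := by
    refine tendstoL0_of_ae ?_
    have e : ∀ᵐ x ∂m, ∀ n, (F.toL0 (c⁻¹ • u (ns n))) x = c⁻¹ * F.toL0 (u (ns n)) x := by
      refine ae_all_iff.2 fun n => ?_
      rw [map_smul]
      exact AEEqFun.coeFn_smul _ _
    filter_upwards [hae, e, AEEqFun.coeFn_smul c f] with x h1 h2 h3
    simp only [h2]
    rw [h3, Pi.smul_apply, smul_eq_mul] at h1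
    have := h1.const_mul c⁻¹
    rwa [inv_mul_cancel_left₀ hc] at this
  have hw : WeakTendstoLp (fun n => F.g (c⁻¹ • u (ns n))) (|c|⁻¹ • G') := by
    intro φ
    simp only [F.g_smul, map_smul, abs_inv]
    exact ((hG' φ).comp hns.tendsto_atTop).const_smul _
  have h := Lp_smul_le (abs_nonneg c) (hG _ _ hconv hw)
  rwa [smul_smul, mul_inv_cancel₀ (abs_ne_zero.2 hc), one_smul] at h

theorem lowerRelax_smul [SigmaFinite m] (hp1 : 1 < p) (hp : p ≠ ∞) (c : ℝ) {f : M →ₘ[m] ℝ}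
    (hf : F.hullEnergy f < ∞) : F.lowerRelax (c • f) = |c| • F.lowerRelax f := by
  rcases eq_or_ne c 0 with rfl | hc
  · simp [F.lowerRelax_zero hp1 hp]
  have hcf : F.hullEnergy (c • f) < ∞ := (F.relaxDomain hp1 hp).smul_mem c hf
  have H := F.isGreatest_lowerRelax hp1 hp hf
  have Hc := F.isGreatest_lowerRelax hp1 hp hcf
  refine le_antisymm ?_ (Hc.2 (F.smul_mem_lowerSet hc H.1))
  have h1 := F.smul_mem_lowerSet (inv_ne_zero hc) Hc.1
  rw [inv_smul_smul₀ hc] at h1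
  have h2 := Lp_smul_le (abs_nonneg c) (H.2 h1)
  rwa [smul_smul, abs_inv, mul_inv_cancel₀ (abs_ne_zero.2 hc), one_smul] at h2

/-- The lower relaxation, as an `L^p`-valued functional on the relaxed domain. -/
noncomputable def relax [SigmaFinite m] (hp1 : 1 < p) (hp : p ≠ ∞) :
    LpFunctional m p (F.relaxDomain hp1 hp) where
  toL0 := (F.relaxDomain hp1 hp).subtype
  g f := F.lowerRelax f
  g_nonneg f := (F.isGreatest_lowerRelax hp1 hp f.2).2 (F.zero_mem_lowerSet f)
  g_add_le f h := F.lowerRelax_add_le hp1 hp f.2 h.2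
  g_smul c f := F.lowerRelax_smul hp1 hp c f.2

/-- Every `f` in the domain of the functional lies in the domain of its relaxation. -/
noncomputable def toRelaxDomain [SigmaFinite m] (hp1 : 1 < p) (hp : p ≠ ∞) :
    V →ₗ[ℝ] F.relaxDomain hp1 hp :=
  F.toL0.codRestrict (F.relaxDomain hp1 hp) fun f =>
    (F.hullEnergy_lt_top_iff hp1 hp).2 ⟨fun _ => f, ‖F.g f‖, by simp, fun _ => le_rfl⟩

end RelaxFunctional

end LpFunctional

/-! ### The module generated by an `L^p`-valued functional -/

namespace LpFunctional

/-- The countably valued approximation `⌊(n + 1) a⌋ / (n + 1)` of `a`. -/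
noncomputable def approx {M : Type*} (a : M → ℝ) (n : ℕ) (x : M) : ℝ := ⌊((n : ℝ) + 1) * a x⌋ / ((n : ℝ) + 1)

theorem abs_approx_sub_le {M : Type*} (a : M → ℝ) (n : ℕ) (x : M) :
    |approx a n x - a x| ≤ 1 / ((n : ℝ) + 1) := by
  have hn : (0 : ℝ) < (n : ℝ) + 1 := by positivity
  have h1 := Int.floor_le (((n : ℝ) + 1) * a x)
  have h2 := Int.lt_floor_add_one (((n : ℝ) + 1) * a x)
  have e : approx a n x - a x =
      (⌊((n : ℝ) + 1) * a x⌋ - ((n : ℝ) + 1) * a x) / ((n : ℝ) + 1) := by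
    rw [approx]; field_simp
  rw [e, abs_div, abs_of_pos hn]
  refine div_le_div_of_nonneg_right ?_ hn.le
  rw [abs_le]; constructor <;> linarith

section Pfm
variable {M : Type*} [MeasurableSpace M] {m : Measure M} {p : ℝ≥0∞} [Fact (1 ≤ p)]
  {V : Type*} [AddCommGroup V] [Module ℝ V] (F : LpFunctional m p V)

/-- The map `s : M → V` takes countably many values, on measurable sets. Such a map is the same
as a family `{(f_i, A_i)}` with `(A_i)` a countable measurable partition: `s = f_i` on `A_i`. -/
def IsCountablyValued {W : Type*} (s : M → W) : Prop :=
  (range s).Countable ∧ ∀ v, MeasurableSet (s ⁻¹' {v})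

theorem IsCountablyValued.measurableSet_preimage {W : Type*} {s : M → W}
    (hs : IsCountablyValued s) (B : Set W) : MeasurableSet (s ⁻¹' B) := by
  have : s ⁻¹' B = ⋃ v ∈ B ∩ range s, s ⁻¹' {v} := by
    ext x; simp
  rw [this]
  exact MeasurableSet.biUnion (hs.1.mono inter_subset_right) fun v _ => hs.2 v

theorem IsCountablyValued.comp₂ {W₁ W₂ W : Type*} {s : M → W₁} {t : M → W₂}
    (hs : IsCountablyValued s) (ht : IsCountablyValued t) (φ : W₁ → W₂ → W) :
    IsCountablyValued fun x => φ (s x) (t x) := by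
  refine ⟨(hs.1.image2 ht.1 φ).mono ?_, fun v => ?_⟩
  · rintro _ ⟨x, rfl⟩
    exact ⟨s x, ⟨x, rfl⟩, t x, ⟨x, rfl⟩, rfl⟩
  · have : (fun x => φ (s x) (t x)) ⁻¹' {v} =
        ⋃ a ∈ range s, s ⁻¹' {a} ∩ t ⁻¹' {b | φ a b = v} := by
      ext x
      simp only [mem_preimage, mem_singleton_iff, mem_iUnion, mem_inter_iff]
      exact ⟨fun h => ⟨s x, ⟨x, rfl⟩, rfl, h⟩, fun ⟨a, _, ha, h⟩ => by rw [ha]; exact h⟩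
    rw [this]
    exact MeasurableSet.biUnion hs.1 fun a _ => (hs.2 a).inter (ht.measurableSet_preimage _)

/-- The function equal to `g_{f_i}` on `A_i`. -/
noncomputable def pointwise (s : M → V) (x : M) : ℝ := F.g (s x) x

theorem aestronglyMeasurable_pointwise {s : M → V} (hs : IsCountablyValued s) :
    AEStronglyMeasurable (F.pointwise s) m := by
  have hm : Measurable (F.pointwise s) := by
    intro B hB
    have : F.pointwise s ⁻¹' B = ⋃ v ∈ range s, s ⁻¹' {v} ∩ (F.g v : M → ℝ) ⁻¹' B := by
      ext x
      simp only [mem_preimage, mem_singleton_iff, mem_iUnion, mem_inter_iff]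
      exact ⟨fun h => ⟨s x, ⟨x, rfl⟩, rfl, h⟩, fun ⟨a, _, ha, h⟩ => by
        rw [pointwise, ha]; exact h⟩
    rw [this]
    exact MeasurableSet.biUnion hs.1 fun v _ =>
      (hs.2 v).inter ((Lp.stronglyMeasurable (F.g v)).measurable hB)
  exact hm.aestronglyMeasurable

theorem pointwise_nonneg {s : M → V} (hs : IsCountablyValued s) :
    ∀ᵐ x ∂m, 0 ≤ F.pointwise s x := by
  have : ∀ᵐ x ∂m, ∀ v ∈ range s, 0 ≤ F.g v x :=
    (ae_ball_iff hs.1).2 fun v _ => (Lp.coeFn_nonneg (F.g v)).2 (F.g_nonneg v)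
  filter_upwards [this] with x h using h _ ⟨x, rfl⟩

theorem pointwise_add_le {s t : M → V} (hs : IsCountablyValued s) (ht : IsCountablyValued t) :
    ∀ᵐ x ∂m, F.pointwise (s + t) x ≤ F.pointwise s x + F.pointwise t x := by
  have : ∀ᵐ x ∂m, ∀ v ∈ range s, ∀ w ∈ range t, F.g (v + w) x ≤ F.g v x + F.g w x := by
    refine (ae_ball_iff hs.1).2 fun v _ => (ae_ball_iff ht.1).2 fun w _ => ?_
    have := (Lp.coeFn_le _ _).2 (F.g_add_le v w)
    filter_upwards [this, Lp.coeFn_add (F.g v) (F.g w)] with x h1 h2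
    rw [h2] at h1; exact h1
  filter_upwards [this] with x h using h _ ⟨x, rfl⟩ _ ⟨x, rfl⟩

theorem pointwise_smul {a : M → ℝ} {s : M → V} (ha : IsCountablyValued a)
    (hs : IsCountablyValued s) :
    ∀ᵐ x ∂m, F.pointwise (fun x => a x • s x) x = |a x| * F.pointwise s x := by
  have : ∀ᵐ x ∂m, ∀ c ∈ range a, ∀ v ∈ range s, F.g (c • v) x = |c| * F.g v x := by
    refine (ae_ball_iff ha.1).2 fun c _ => (ae_ball_iff hs.1).2 fun v _ => ?_
    rw [F.g_smul]
    exact Lp.coeFn_smul |c| (F.g v)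
  filter_upwards [this] with x h using h _ ⟨x, rfl⟩ _ ⟨x, rfl⟩

theorem isCountablyValued_const {W : Type*} (w : W) : IsCountablyValued fun _ : M => w :=
  ⟨(countable_singleton w).mono (by rintro _ ⟨x, rfl⟩; rfl),
    fun v => by by_cases h : w = v <;> simp [h]⟩

/-- The families `{(f_i, A_i)}` with `∑ ∫_{A_i} g_{f_i} ^ p < ∞`, as a vector space. -/
def pfm : Submodule ℝ (M → V) where
  carrier := {s | IsCountablyValued s ∧ MemLp (F.pointwise s) p m}
  zero_mem' := by
    refine ⟨isCountablyValued_const 0, ?_⟩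
    have : F.pointwise (0 : M → V) = F.g 0 := rfl
    rw [this]; exact Lp.memLp _
  add_mem' := by
    rintro s t ⟨hs, hs'⟩ ⟨ht, ht'⟩
    have hst : IsCountablyValued (s + t) := hs.comp₂ ht (· + ·)
    refine ⟨hst, (hs'.add ht').mono (F.aestronglyMeasurable_pointwise hst) ?_⟩
    filter_upwards [F.pointwise_add_le hs ht, F.pointwise_nonneg hst, F.pointwise_nonneg hs,
      F.pointwise_nonneg ht] with x h1 h2 h3 h4
    rw [Pi.add_apply, Real.norm_of_nonneg h2, Real.norm_of_nonneg (add_nonneg h3 h4)]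
    exact h1
  smul_mem' := by
    rintro c s ⟨hs, hs'⟩
    have hcs : IsCountablyValued (c • s) := (isCountablyValued_const c).comp₂ hs (· • ·)
    refine ⟨hcs, (hs'.const_mul |c|).mono (F.aestronglyMeasurable_pointwise hcs) ?_⟩
    filter_upwards [F.pointwise_smul (isCountablyValued_const c) hs] with x h1
    exact (congrArg norm h1).le

/-- `pfm` as a type, carrying the seminorm `‖s‖ = ‖ |s| ‖_{L^p}`. -/
def Pfm : Type _ := F.pfm

noncomputable instance : AddCommGroup F.Pfm := inferInstanceAs (AddCommGroup F.pfm)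
noncomputable instance : Module ℝ F.Pfm := inferInstanceAs (Module ℝ F.pfm)

/-- The underlying map of an element of `Pfm`. -/
def Pfm.val {F : LpFunctional m p V} (s : F.Pfm) : M → V := Subtype.val s

/-- The pointwise norm `|s|` as an element of `L^p(m)`. -/
noncomputable def Pfm.pointwiseNorm {F : LpFunctional m p V} (s : F.Pfm) : Lp ℝ p m :=
  MemLp.toLp (F.pointwise s.val) s.2.2

theorem Pfm.coeFn_pointwiseNorm {F : LpFunctional m p V} (s : F.Pfm) :
    s.pointwiseNorm =ᵐ[m] F.pointwise s.val := MemLp.coeFn_toLp _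

theorem Pfm.pointwiseNorm_nonneg {F : LpFunctional m p V} (s : F.Pfm) : 0 ≤ s.pointwiseNorm := by
  rw [← Lp.coeFn_nonneg]
  filter_upwards [s.coeFn_pointwiseNorm, F.pointwise_nonneg s.2.1] with x h1 h2
  rw [h1]; exact h2

theorem Pfm.pointwiseNorm_add_le {F : LpFunctional m p V} (s t : F.Pfm) :
    (s + t).pointwiseNorm ≤ s.pointwiseNorm + t.pointwiseNorm := by
  rw [← Lp.coeFn_le]
  filter_upwards [s.coeFn_pointwiseNorm, t.coeFn_pointwiseNorm, (s + t).coeFn_pointwiseNorm,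
    Lp.coeFn_add s.pointwiseNorm t.pointwiseNorm, F.pointwise_add_le s.2.1 t.2.1]
    with x h1 h2 h3 h4 h5
  rw [h3, h4, Pi.add_apply, h1, h2]; exact h5

theorem Pfm.pointwiseNorm_smul {F : LpFunctional m p V} (c : ℝ) (s : F.Pfm) :
    (c • s).pointwiseNorm = |c| • s.pointwiseNorm := by
  refine Lp.ext ?_
  filter_upwards [s.coeFn_pointwiseNorm, (c • s).coeFn_pointwiseNorm,
    Lp.coeFn_smul |c| s.pointwiseNorm, F.pointwise_smul (isCountablyValued_const c) s.2.1]
    with x h1 h2 h3 h4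
  rw [h2, h3, Pi.smul_apply, h1]; exact h4

noncomputable instance : Norm F.Pfm := ⟨fun s => ‖s.pointwiseNorm‖⟩

theorem Pfm.norm_def {F : LpFunctional m p V} (s : F.Pfm) : ‖s‖ = ‖s.pointwiseNorm‖ := rfl

theorem Pfm.core : SeminormedSpace.Core ℝ F.Pfm where
  norm_nonneg s := norm_nonneg s.pointwiseNorm
  norm_smul c s := by
    rw [Pfm.norm_def, Pfm.norm_def, Pfm.pointwiseNorm_smul, norm_smul, Real.norm_eq_abs, abs_abs,
      Real.norm_eq_abs]
  norm_triangle s t :=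
    (Lp_norm_mono (s + t).pointwiseNorm_nonneg (s.pointwiseNorm_add_le t)).trans (norm_add_le _ _)

noncomputable instance : SeminormedAddCommGroup F.Pfm := SeminormedAddCommGroup.ofCore (Pfm.core F)

noncomputable instance : NormedSpace ℝ F.Pfm where
  norm_smul_le c s := ((Pfm.core F).norm_smul c s).le

/-- The `F`-module: the (separated) completion of `Pfm`. -/
abbrev LpModule : Type _ := UniformSpace.Completion F.Pfm

/-- The differential `d f = [f, M]`, on the dense subspace. -/
noncomputable def dPfm : V →ₗ[ℝ] F.Pfm where
  toFun f := ⟨fun _ => f, isCountablyValued_const f, Lp.memLp (F.g f)⟩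
  map_add' _ _ := rfl
  map_smul' _ _ := rfl

/-- The differential `d f = [f, M]`. -/
noncomputable def d (f : V) : F.LpModule := (F.dPfm f : F.Pfm)

theorem Pfm.lipschitz_pointwiseNorm :
    LipschitzWith 1 (Pfm.pointwiseNorm : F.Pfm → Lp ℝ p m) := by
  refine LipschitzWith.of_dist_le_mul fun s t => ?_
  rw [NNReal.coe_one, one_mul, dist_eq_norm, dist_eq_norm, Pfm.norm_def]
  refine norm_le_norm_of_abs_le_abs ?_
  rw [abs_of_nonneg (s - t).pointwiseNorm_nonneg]
  have h1 := Pfm.pointwiseNorm_add_le (s - t) t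
  have h2 := Pfm.pointwiseNorm_add_le (t - s) s
  have h3 : (t - s).pointwiseNorm = (s - t).pointwiseNorm := by
    have := Pfm.pointwiseNorm_smul (-1) (s - t)
    rw [neg_smul, one_smul, neg_sub, abs_neg, abs_one, one_smul] at this
    exact this
  rw [sub_add_cancel] at h1 h2
  rw [h3] at h2
  exact abs_le'.2 ⟨sub_le_iff_le_add.2 h1, by rw [neg_sub]; exact sub_le_iff_le_add.2 h2⟩

/-- The pointwise norm `|·|` of the `F`-module, extended by continuity. -/
noncomputable def pointwiseNorm (v : F.LpModule) : Lp ℝ p m :=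
  UniformSpace.Completion.extension (Pfm.pointwiseNorm : F.Pfm → Lp ℝ p m) v

theorem isCountablyValued_approx {a : M → ℝ} (ha : Measurable a) (n : ℕ) :
    IsCountablyValued (approx a n) := by
  have h1 : Measurable (approx a n) := by
    have : Measurable fun x => ⌊((n : ℝ) + 1) * a x⌋ := (ha.const_mul _).floor
    exact ((measurable_from_top (f := fun k : ℤ => (k : ℝ))).comp this).div_const _
  refine ⟨(countable_range fun k : ℤ => (k : ℝ) / ((n : ℝ) + 1)).mono ?_,
    fun v => h1 (measurableSet_singleton v)⟩
  rintro _ ⟨x, rfl⟩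
  exact ⟨⌊((n : ℝ) + 1) * a x⌋, rfl⟩

theorem ae_abs_le (a : Lp ℝ ∞ m) : ∀ᵐ x ∂m, |a x| ≤ ‖a‖ := by
  have h := ae_le_eLpNormEssSup (f := (a : M → ℝ)) (μ := m)
  filter_upwards [h] with x hx
  rw [Lp.norm_def, eLpNorm_exponent_top, ← Real.norm_eq_abs, ← toReal_enorm]
  refine ENNReal.toReal_mono ?_ hx
  rw [← eLpNorm_exponent_top]; exact Lp.eLpNorm_ne_top a

/-- Multiplication of `s` in `Pfm` by the countably valued approximation `approx a n`,
i.e. `[(f_i, A_i)] ↦ [(a_j f_i, A_i ∩ B_j)]`. -/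
noncomputable def approxMul (a : Lp ℝ ∞ m) (n : ℕ) : F.Pfm →ₗ[ℝ] F.Pfm where
  toFun s := ⟨fun x => approx a n x • s.val x, by
    have ha := isCountablyValued_approx (Lp.stronglyMeasurable a).measurable n
    have hc := ha.comp₂ s.2.1 (· • ·)
    refine ⟨hc, (s.2.2.const_mul (‖a‖ + 1)).mono (F.aestronglyMeasurable_pointwise hc) ?_⟩
    filter_upwards [F.pointwise_smul ha s.2.1, ae_abs_le a] with x h1 h2
    refine (congrArg norm h1).le.trans ?_
    have h6 : ‖‖a‖ + 1‖ = ‖a‖ + 1 := Real.norm_of_nonneg (add_nonneg (norm_nonneg a) zero_le_one)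
    rw [norm_mul, norm_mul, h6, Real.norm_eq_abs, abs_abs]
    refine mul_le_mul_of_nonneg_right ?_ (norm_nonneg _)
    have h3 := abs_approx_sub_le a n x
    have h4 : 1 / ((n : ℝ) + 1) ≤ 1 := by
      rw [div_le_one (by positivity)]; linarith [(Nat.cast_nonneg n : (0 : ℝ) ≤ n)]
    have h5 := abs_sub_abs_le_abs_sub (approx a n x) (a x)
    linarith⟩
  map_add' s t := Subtype.ext <| funext fun x => smul_add _ _ _
  map_smul' c s := Subtype.ext <| funext fun x => smul_comm _ _ _

theorem norm_approxMul_sub_le (a : Lp ℝ ∞ m) (n k : ℕ) (s : F.Pfm) :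
    ‖F.approxMul a n s - F.approxMul a k s‖ ≤
      (1 / ((n : ℝ) + 1) + 1 / ((k : ℝ) + 1)) * ‖s‖ := by
  set c : ℝ := 1 / ((n : ℝ) + 1) + 1 / ((k : ℝ) + 1) with hc
  have hc0 : 0 ≤ c := by positivity
  have hn := isCountablyValued_approx (Lp.stronglyMeasurable a).measurable n
  have hk := isCountablyValued_approx (Lp.stronglyMeasurable a).measurable k
  rw [Pfm.norm_def, Pfm.norm_def]
  refine Lp.norm_le_mul_norm_of_ae_le_mul ?_
  filter_upwards [s.coeFn_pointwiseNorm, (F.approxMul a n s - F.approxMul a k s).coeFn_pointwiseNorm,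
    F.pointwise_smul (hn.comp₂ hk (· - ·)) s.2.1] with x h1 h2 h3
  have e : (F.approxMul a n s - F.approxMul a k s).val =
      fun x => (approx a n x - approx a k x) • s.val x :=
    funext fun x => (sub_smul _ _ _).symm
  rw [h2, e, h1]
  refine (congrArg norm h3).le.trans ?_
  rw [norm_mul, Real.norm_eq_abs, abs_abs]
  refine mul_le_mul_of_nonneg_right ?_ (norm_nonneg _)
  have h4 := abs_approx_sub_le a n x
  have h5 := abs_approx_sub_le a k x
  rw [abs_le] at h4 h5 ⊢
  constructor <;> linarith

theorem norm_approxMul_le (a : Lp ℝ ∞ m) (n : ℕ) (s : F.Pfm) :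
    ‖F.approxMul a n s‖ ≤ (‖a‖ + 1) * ‖s‖ := by
  have hn := isCountablyValued_approx (Lp.stronglyMeasurable a).measurable n
  rw [Pfm.norm_def, Pfm.norm_def]
  refine Lp.norm_le_mul_norm_of_ae_le_mul ?_
  filter_upwards [s.coeFn_pointwiseNorm, (F.approxMul a n s).coeFn_pointwiseNorm,
    F.pointwise_smul hn s.2.1, ae_abs_le a] with x h1 h2 h3 h4
  rw [h1, h2]
  refine (congrArg norm h3).le.trans ?_
  rw [norm_mul, Real.norm_eq_abs, abs_abs]
  refine mul_le_mul_of_nonneg_right ?_ (norm_nonneg _)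
  have h5 := abs_approx_sub_le a n x
  have h6 : 1 / ((n : ℝ) + 1) ≤ 1 := by
    rw [div_le_one (by positivity)]; linarith [(Nat.cast_nonneg n : (0 : ℝ) ≤ n)]
  have h7 := abs_sub_abs_le_abs_sub (approx a n x) (a x)
  linarith

theorem uniformContinuous_approxMul (a : Lp ℝ ∞ m) (n : ℕ) :
    UniformContinuous (F.approxMul a n) :=
  ((F.approxMul a n).mkContinuous (‖a‖ + 1) (F.norm_approxMul_le a n)).uniformContinuous

/-- Multiplication of elements of the `F`-module by `L^∞`-functions, extended by continuity from
`Pfm` and from countably valued functions (the limit exists, see `tendsto_linftyMul`). -/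
noncomputable def linftyMul (a : Lp ℝ ∞ m) (v : F.LpModule) : F.LpModule :=
  limUnder atTop fun n => UniformSpace.Completion.map (F.approxMul a n) v

theorem tendsto_linftyMul (a : Lp ℝ ∞ m) (v : F.LpModule) :
    Tendsto (fun n => UniformSpace.Completion.map (F.approxMul a n) v) atTop
      (𝓝 (F.linftyMul a v)) := by
  have hbound : ∀ (n k : ℕ) (w : F.LpModule),
      ‖UniformSpace.Completion.map (F.approxMul a n) w -
        UniformSpace.Completion.map (F.approxMul a k) w‖ ≤
      (1 / ((n : ℝ) + 1) + 1 / ((k : ℝ) + 1)) * ‖w‖ := by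
    intro n k w
    induction w using UniformSpace.Completion.induction_on with
    | hp =>
      have h1 : Continuous (UniformSpace.Completion.map (F.approxMul a n)) :=
        UniformSpace.Completion.continuous_map
      have h2 : Continuous (UniformSpace.Completion.map (F.approxMul a k)) :=
        UniformSpace.Completion.continuous_map
      exact isClosed_le (h1.sub h2).norm (continuous_const.mul continuous_norm)
    | ih s =>
      rw [UniformSpace.Completion.map_coe (F.uniformContinuous_approxMul a n),
        UniformSpace.Completion.map_coe (F.uniformContinuous_approxMul a k),
        ← UniformSpace.Completion.coe_sub, UniformSpace.Completion.norm_coe,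
        UniformSpace.Completion.norm_coe]
      exact F.norm_approxMul_sub_le a n k s
  have hcau : CauchySeq fun n => UniformSpace.Completion.map (F.approxMul a n) v := by
    refine cauchySeq_of_le_tendsto_0 (fun n : ℕ => 2 * (1 / ((n : ℝ) + 1)) * ‖v‖) ?_ ?_
    · intro n k N hn hk
      rw [dist_eq_norm]
      refine (hbound n k v).trans (mul_le_mul_of_nonneg_right ?_ (norm_nonneg v))
      have h1 : 1 / ((n : ℝ) + 1) ≤ 1 / ((N : ℝ) + 1) := Nat.one_div_le_one_div hn
      have h2 : 1 / ((k : ℝ) + 1) ≤ 1 / ((N : ℝ) + 1) := Nat.one_div_le_one_div hk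
      linarith
    · simpa using ((tendsto_one_div_add_atTop_nhds_zero_nat (𝕜 := ℝ)).const_mul 2).mul_const ‖v‖
  exact hcau.tendsto_limUnder

theorem pointwiseNorm_coe (s : F.Pfm) : F.pointwiseNorm (s : F.LpModule) = s.pointwiseNorm :=
  UniformSpace.Completion.extension_coe (Pfm.lipschitz_pointwiseNorm F).uniformContinuous s

end Pfm

end LpFunctional

/-! ### The local Lipschitz constant -/

section Lip
variable {M : Type*} [MetricSpace M]

/-- The local Lipschitz constant `limsup_{y → x} |f y - f x| / d(y, x)`
(equal to `0` at isolated points). -/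
noncomputable def elip (f : M → ℝ) (x : M) : ℝ≥0∞ :=
  limsup (fun y => edist (f y) (f x) / edist y x) (𝓝[≠] x)

/-- The local Lipschitz constant as a real number (finite for Lipschitz `f`). -/
noncomputable def lip (f : M → ℝ) (x : M) : ℝ := (elip f x).toReal

theorem elip_le {f : M → ℝ} {K : ℝ≥0} (hf : LipschitzWith K f) (x : M) : elip f x ≤ K := by
  refine limsup_le_of_le (by isBoundedDefault) ?_
  exact Eventually.of_forall fun y => ENNReal.div_le_of_le_mul (hf y x)

theorem elip_add_le (f h : M → ℝ) (x : M) : elip (f + h) x ≤ elip f x + elip h x := by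
  refine ENNReal.le_of_forall_pos_le_add fun ε hε htop => ?_
  obtain ⟨h1, h2⟩ := ENNReal.add_lt_top.1 htop
  have hε2 : (ε : ℝ≥0∞) / 2 ≠ 0 := (ENNReal.half_pos (by exact_mod_cast hε.ne')).ne'
  have e1 := eventually_lt_of_limsup_lt (ENNReal.lt_add_right h1.ne hε2)
  have e2 := eventually_lt_of_limsup_lt (ENNReal.lt_add_right h2.ne hε2)
  refine limsup_le_of_le (by isBoundedDefault) ?_
  filter_upwards [e1, e2] with y h3 h4
  calc edist ((f + h) y) ((f + h) x) / edist y x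
      ≤ (edist (f y) (f x) + edist (h y) (h x)) / edist y x :=
        ENNReal.div_le_div_right (edist_add_add_le _ _ _ _) _
    _ = edist (f y) (f x) / edist y x + edist (h y) (h x) / edist y x := ENNReal.add_div
    _ ≤ (elip f x + ε / 2) + (elip h x + ε / 2) := add_le_add h3.le h4.le
    _ = elip f x + elip h x + (ε / 2 + ε / 2) := by ring
    _ = elip f x + elip h x + ε := by rw [ENNReal.add_halves]

theorem elip_smul (c : ℝ) (f : M → ℝ) (x : M) : elip (c • f) x = ENNReal.ofReal |c| * elip f x := by
  have e : ∀ y, edist ((c • f) y) ((c • f) x) / edist y x =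
      ENNReal.ofReal |c| * (edist (f y) (f x) / edist y x) := by
    intro y
    rw [← mul_div_assoc]
    congr 1
    simp only [Pi.smul_apply, smul_eq_mul, edist_dist, Real.dist_eq, ← mul_sub, abs_mul]
    exact ENNReal.ofReal_mul (abs_nonneg c)
  simp only [elip, e]
  exact ENNReal.limsup_const_mul_of_ne_top ENNReal.ofReal_ne_top

theorem elip_ne_top {f : M → ℝ} (hf : ∃ K, LipschitzWith K f) (x : M) : elip f x ≠ ∞ := by
  obtain ⟨K, hK⟩ := hf
  exact ((elip_le hK x).trans_lt ENNReal.coe_lt_top).ne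

theorem lip_add_le {f h : M → ℝ} (hf : ∃ K, LipschitzWith K f) (hh : ∃ K, LipschitzWith K h)
    (x : M) : lip (f + h) x ≤ lip f x + lip h x := by
  rw [lip, lip, lip, ← ENNReal.toReal_add (elip_ne_top hf x) (elip_ne_top hh x)]
  exact ENNReal.toReal_mono (ENNReal.add_ne_top.2 ⟨elip_ne_top hf x, elip_ne_top hh x⟩)
    (elip_add_le f h x)

theorem lip_smul (c : ℝ) (f : M → ℝ) (x : M) : lip (c • f) x = |c| * lip f x := by
  rw [lip, lip, elip_smul, ENNReal.toReal_mul, ENNReal.toReal_ofReal (abs_nonneg c)]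

theorem lip_nonneg (f : M → ℝ) (x : M) : 0 ≤ lip f x := ENNReal.toReal_nonneg

theorem measurable_elip [MeasurableSpace M] [BorelSpace M] {f : M → ℝ} (hf : Continuous f) :
    Measurable (elip f) := by
  have key : ∀ x, elip f x = ⨅ n : ℕ, ⨆ y ∈ {y | y ≠ x ∧ edist y x < ((n : ℝ≥0∞) + 1)⁻¹},
      edist (f y) (f x) / edist y x := by
    intro x
    have hb : (𝓝[≠] x).HasBasis (fun _ : ℕ => True)
        (fun n => {y | y ≠ x ∧ edist y x < ((n : ℝ≥0∞) + 1)⁻¹}) := by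
      refine hasBasis_iff.2 fun t => ?_
      rw [mem_nhdsWithin_iff_exists_mem_nhds_inter]
      constructor
      · rintro ⟨u, hu, hut⟩
        obtain ⟨δ, hδ, hball⟩ := EMetric.mem_nhds_iff.1 hu
        obtain ⟨n, hn⟩ := ENNReal.exists_inv_nat_lt hδ.ne'
        refine ⟨n, trivial, fun y hy => hut ⟨hball ?_, hy.1⟩⟩
        refine lt_of_lt_of_le hy.2 (le_trans ?_ hn.le)
        exact ENNReal.inv_le_inv.2 le_self_add
      · rintro ⟨n, -, hn⟩
        refine ⟨Metric.eball x ((n : ℝ≥0∞) + 1)⁻¹, Metric.eball_mem_nhds _ ?_,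
          fun y hy => hn ⟨hy.2, hy.1⟩⟩
        exact ENNReal.inv_pos.2 (by finiteness)
    simp only [elip, hb.limsup_eq_iInf_iSup, iInf_true]
  have : elip f = fun x => ⨅ n : ℕ, ⨆ y ∈ {y | y ≠ x ∧ edist y x < ((n : ℝ≥0∞) + 1)⁻¹},
      edist (f y) (f x) / edist y x := funext key
  rw [this]
  refine Measurable.iInf fun n => LowerSemicontinuous.measurable ?_
  intro x c hc
  simp only [lt_iSup_iff] at hc
  obtain ⟨y, ⟨hy1, hy2⟩, hy3⟩ := hc
  have h1 : ∀ᶠ z in 𝓝 x, y ≠ z := by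
    filter_upwards [isOpen_ne.mem_nhds (Ne.symm hy1)] with z hz using Ne.symm hz
  have h2 : ∀ᶠ z in 𝓝 x, edist y z < ((n : ℝ≥0∞) + 1)⁻¹ :=
    (continuous_const.edist continuous_id).tendsto x |>.eventually_lt_const hy2
  have h3 : ∀ᶠ z in 𝓝 x, c < edist (f y) (f z) / edist y z := by
    have ht : Tendsto (fun z => edist (f y) (f z) / edist y z) (𝓝 x)
        (𝓝 (edist (f y) (f x) / edist y x)) := by
      refine ENNReal.Tendsto.div ((continuous_const.edist hf).tendsto x) (Or.inr ?_)
        ((continuous_const.edist continuous_id).tendsto x) (Or.inr ?_)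
      · exact edist_pos.2 hy1 |>.ne'
      · exact edist_ne_top _ _
    exact ht.eventually_const_lt hy3
  filter_upwards [h1, h2, h3] with z e1 e2 e3
  exact lt_of_lt_of_le e3 (le_iSup₂ (f := fun y (_ : y ∈ {y | y ≠ z ∧
    edist y z < ((n : ℝ≥0∞) + 1)⁻¹}) => edist (f y) (f z) / edist y z) y ⟨e1, e2⟩)

variable [MeasurableSpace M] [BorelSpace M]

/-- The domain of the Lipschitz energy: Lipschitz functions with `lip f ∈ L^p(m)`. -/
def lipDomain (m : Measure M) (p : ℝ≥0∞) : Submodule ℝ (M → ℝ) where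
  carrier := {f | (∃ K, LipschitzWith K f) ∧ MemLp (lip f) p m}
  zero_mem' := by
    refine ⟨⟨0, LipschitzWith.const 0⟩, ?_⟩
    have : lip (0 : M → ℝ) = 0 := by
      funext x
      have := lip_smul 0 (0 : M → ℝ) x
      simpa using this
    rw [this]; exact MemLp.zero
  add_mem' := by
    rintro f h ⟨hf1, hf⟩ ⟨hh1, hh⟩
    have hfh : ∃ K, LipschitzWith K (f + h) := by
      obtain ⟨K, hK⟩ := hf1
      obtain ⟨L, hL⟩ := hh1
      exact ⟨K + L, hK.add hL⟩
    have hc : Continuous (f + h) := hfh.choose_spec.continuous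
    refine ⟨hfh, (hf.add hh).mono (measurable_elip hc).ennreal_toReal.aestronglyMeasurable ?_⟩
    refine Eventually.of_forall fun x => ?_
    rw [Pi.add_apply, Real.norm_of_nonneg (lip_nonneg _ _),
      Real.norm_of_nonneg (add_nonneg (lip_nonneg _ _) (lip_nonneg _ _))]
    exact lip_add_le hf1 hh1 x
  smul_mem' := by
    rintro c f ⟨⟨K, hK⟩, hf⟩
    refine ⟨⟨_, (lipschitzWith_smul c).comp hK⟩, ?_⟩
    have : lip (c • f) = fun x => |c| * lip f x := funext (lip_smul c f)
    rw [this]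
    exact hf.const_mul |c|

/-- The functional `f ↦ lip f` on Lipschitz functions with `lip f ∈ L^p(m)`. -/
noncomputable def lipFunctional (m : Measure M) (p : ℝ≥0∞) [Fact (1 ≤ p)] :
    LpFunctional m p (lipDomain m p) where
  toL0 :=
    { toFun := fun f => AEEqFun.mk (f : M → ℝ)
        f.2.1.choose_spec.continuous.aestronglyMeasurable
      map_add' := fun _ _ => rfl
      map_smul' := fun _ _ => rfl }
  g f := MemLp.toLp (lip (f : M → ℝ)) f.2.2
  g_nonneg f := by
    rw [← Lp.coeFn_nonneg]
    filter_upwards [MemLp.coeFn_toLp f.2.2] with x hx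
    rw [hx]; exact lip_nonneg _ _
  g_add_le f h := by
    rw [← Lp.coeFn_le]
    filter_upwards [MemLp.coeFn_toLp f.2.2, MemLp.coeFn_toLp h.2.2, MemLp.coeFn_toLp (f + h).2.2,
      Lp.coeFn_add (MemLp.toLp _ f.2.2) (MemLp.toLp _ h.2.2)] with x h1 h2 h3 h4
    rw [h3, h4, Pi.add_apply, h1, h2]
    exact lip_add_le f.2.1 h.2.1 x
  g_smul c f := by
    refine Lp.ext ?_
    have h1 := MemLp.coeFn_toLp f.2.2
    have h2 := MemLp.coeFn_toLp (c • f).2.2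
    have h3 := Lp.coeFn_smul |c| (MemLp.toLp (lip (f : M → ℝ)) f.2.2)
    filter_upwards [h1, h2, h3] with x h1 h2 h3
    rw [h2, h3, Pi.smul_apply, h1, smul_eq_mul, ← lip_smul]
    rfl

/-- The measure is finite on bounded sets. -/
class IsFiniteOnBounded (m : Measure M) : Prop where
  lt_top : ∀ s : Set M, Bornology.IsBounded s → m s < ∞

instance (m : Measure M) [IsFiniteOnBounded m] : SigmaFinite m := by
  rcases isEmpty_or_nonempty M with h | ⟨⟨x⟩⟩
  · have : m = 0 := Measure.eq_zero_of_isEmpty m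
    rw [this]; infer_instance
  · refine ⟨⟨⟨fun n : ℕ => Metric.ball x n, fun _ => trivial,
      fun n => IsFiniteOnBounded.lt_top _ Metric.isBounded_ball, ?_⟩⟩⟩
    exact Metric.iUnion_ball_nat x

end Lip

/-! ### Normed modules, submodules and differentials -/

namespace LpFunctional

section Submodule
variable {M : Type*} [MeasurableSpace M] {m : Measure M} {p : ℝ≥0∞} [Fact (1 ≤ p)]
  {V : Type*} [AddCommGroup V] [Module ℝ V] (F : LpFunctional m p V)

/-- The characteristic function of a measurable set, as an element of `L^∞(m)`. -/
noncomputable def chi (m : Measure M) {A : Set M} (hA : MeasurableSet A) : Lp ℝ ∞ m :=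
  MemLp.toLp (A.indicator fun _ => (1 : ℝ)) ((memLp_top_const (1 : ℝ)).indicator hA)

/-- A linear subspace `N` of the `F`-module is a submodule: it is closed, stable under
`L^∞`-multiplication, and an `L^p(m)`-normed module with the inherited operations. -/
structure IsSubmodule (N : Submodule ℝ F.LpModule) : Prop where
  isClosed : IsClosed (N : Set F.LpModule)
  mul_mem : ∀ (a : Lp ℝ ∞ m), ∀ v ∈ N, F.linftyMul a v ∈ N
  add_mul : ∀ (a b : Lp ℝ ∞ m), ∀ v ∈ N,
    F.linftyMul (a + b) v = F.linftyMul a v + F.linftyMul b v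
  smul_mul : ∀ (c : ℝ) (a : Lp ℝ ∞ m), ∀ v ∈ N, F.linftyMul (c • a) v = c • F.linftyMul a v
  mul_add : ∀ (a : Lp ℝ ∞ m), ∀ v ∈ N, ∀ w ∈ N,
    F.linftyMul a (v + w) = F.linftyMul a v + F.linftyMul a w
  mul_smul : ∀ (c : ℝ) (a : Lp ℝ ∞ m), ∀ v ∈ N, F.linftyMul a (c • v) = c • F.linftyMul a v
  mul_mul : ∀ (a b : Lp ℝ ∞ m), ∀ v ∈ N,
    F.linftyMul (a • b : Lp ℝ ∞ m) v = F.linftyMul a (F.linftyMul b v)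
  one_mul : ∀ v ∈ N, F.linftyMul (chi m MeasurableSet.univ) v = v
  norm_eq : ∀ v ∈ N, ‖v‖ = ‖F.pointwiseNorm v‖
  pointwiseNorm_mul : ∀ (a : Lp ℝ ∞ m), ∀ v ∈ N,
    F.pointwiseNorm (F.linftyMul a v) = (|a| • F.pointwiseNorm v : Lp ℝ p m)
  locality : ∀ v ∈ N, ∀ (A : ℕ → Set M) (hA : ∀ n, MeasurableSet (A n)),
    (∀ n, F.linftyMul (chi m (hA n)) v = 0) →
      F.linftyMul (chi m (MeasurableSet.iUnion hA)) v = 0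
  glueing : ∀ (v : ℕ → F.LpModule) (A : ℕ → Set M) (hA : ∀ n, MeasurableSet (A n)),
    (∀ n, v n ∈ N) →
    (∀ i j, F.linftyMul (chi m ((hA i).inter (hA j))) (v i) =
      F.linftyMul (chi m ((hA i).inter (hA j))) (v j)) →
    limsup (fun n => ‖∑ i ∈ Finset.range n, F.linftyMul (chi m (hA i)) (v i)‖ₑ) atTop < ∞ →
    ∃ w ∈ N, (∀ i, F.linftyMul (chi m (hA i)) w = F.linftyMul (chi m (hA i)) (v i)) ∧
      ‖w‖ₑ ≤ liminf (fun n => ‖∑ i ∈ Finset.range n, F.linftyMul (chi m (hA i)) (v i)‖ₑ) atTop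

/-- The differential is closable as a partially defined operator from `L^0(m)` to the module. -/
def IsClosable : Prop :=
  ∀ (u : ℕ → V) (ω : F.LpModule), F.ConvergesTo u 0 →
    Tendsto (fun n => F.d (u n)) atTop (𝓝 ω) → ω = 0

/-- `i` embeds the module of `F` isometrically into the module of `F'`, compatibly with the
`L^∞`-module structure, the pointwise norms, and the differentials (along `j : V → V'`). -/
structure IsModuleEmbedding {V' : Type*} [AddCommGroup V'] [Module ℝ V']
    (F' : LpFunctional m p V') (j : V →ₗ[ℝ] V') (i : F.LpModule →ₗᵢ[ℝ] F'.LpModule) : Prop where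
  map_mul : ∀ (a : Lp ℝ ∞ m) (v : F.LpModule), i (F.linftyMul a v) = F'.linftyMul a (i v)
  map_pointwiseNorm : ∀ v : F.LpModule, F'.pointwiseNorm (i v) = F.pointwiseNorm v
  map_d : ∀ f : V, i (F.d f) = F'.d (j f)

end Submodule

end LpFunctional

section Modules
variable {M : Type*} [MetricSpace M] [MeasurableSpace M] [BorelSpace M]

/-- The lower relaxation of `f ↦ lip f`: the functional sending `f` to its relaxed slope. -/
noncomputable abbrev relaxedSlope (m : Measure M) [SigmaFinite m] (p : ℝ≥0∞) [Fact (1 ≤ p)]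
    (hp1 : 1 < p) (hp : p ≠ ∞) :
    LpFunctional m p ((lipFunctional m p).relaxDomain hp1 hp) :=
  (lipFunctional m p).relax hp1 hp

/-- The `L^p`-Lipschitz module. -/
abbrev LipschitzModule (m : Measure M) (p : ℝ≥0∞) [Fact (1 ≤ p)] : Type _ :=
  (lipFunctional m p).LpModule

/-- The `L^p`-cotangent module. -/
abbrev CotangentModule (m : Measure M) [SigmaFinite m] (p : ℝ≥0∞) [Fact (1 ≤ p)]
    (hp1 : 1 < p) (hp : p ≠ ∞) : Type _ :=
  (relaxedSlope m p hp1 hp).LpModule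

end Modules

namespace LpFunctional

/-! ### Closability of functionals whose strong upper relaxations at `0` vanish -/

section Closability
variable {M : Type*} [MeasurableSpace M] {m : Measure M} {p : ℝ≥0∞} [Fact (1 ≤ p)]
  {V : Type*} [AddCommGroup V] [Module ℝ V] (F : LpFunctional m p V)

/-! The argument is carried out for an abstract nonnegative, subadditive, absolutely homogeneous
functional `g` with values in `L^p`; the Lipschitz slope enters only at the very end.

The key fact is that a bounded sequence `g (u n)` yields strong upper relaxations. Minimize `‖g w‖`
over the convex hulls of the tails of `u`: uniform convexity of `L^p` makes `g` converge strongly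
along asymptotically minimizing sequences. If the minimizers `h n` are chosen with care, convex
combinations of their tails are again asymptotically minimizing, so `g` has the same limit along all
of these (`exists_stable_convex`). If moreover `u n → f` in `L^0`, this is applied to a subsequence
of `u n - f`, which converges to `0`: the limit is a strong upper relaxation at `0`, hence vanishes
by hypothesis. Adding `f` back gives convex combinations `v n` of tails of `u` with `g (v n) → g f`
strongly (`exists_convex_tendsto_g`).

Three conclusions follow from this. Sublevel sets of the energy are convex, so bounds on `g (u n)`
pass to `v n` and then to `f`, which is lower semicontinuity. Closability is lower semicontinuity
applied to `u n - u k` as `k → ∞`. Finally, `g (v n)` lies below convex combinations of the `g (u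
k)`, so `g f` lies below every weak limit of `g (u n)`; the relaxed slope therefore coincides with
`g` on the original domain (`lowerRelax_toL0`).

Since the two functionals agree there, sending `{(f_i, A_i)}` to the same family in the larger
domain preserves pointwise norms and extends to the completions as the embedding
(`exists_isModuleEmbedding`). Uniqueness and surjectivity both rest on one generation principle,
`eq_top_of_d_mem`: the differentials and multiplication by characteristic functions generate the
module. The image is closed and stable under multiplication, and every such subspace is itself an
`L^p`-normed module. Most of its axioms are checked on families with countably many values and
extended by density; glueing uses that an increasing bounded sequence in `L^p` converges
(`exists_glue`). -/

theorem g_neg (f : V) : F.g (-f) = F.g f := by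
  have := F.g_smul (-1) f
  rwa [neg_smul, one_smul, abs_neg, abs_one, one_smul] at this

theorem abs_g_sub_le (f h : V) : |F.g f - F.g h| ≤ F.g (f - h) := by
  have h1 := F.g_add_le (f - h) h
  have h2 := F.g_add_le (h - f) f
  rw [sub_add_cancel] at h1 h2
  rw [← neg_sub, g_neg] at h2
  exact abs_le'.2 ⟨sub_le_iff_le_add.2 h1, by rw [neg_sub]; exact sub_le_iff_le_add.2 h2⟩

/-- A reverse triangle inequality: a perturbation with small `g` changes `g` little, which is what
permits subtracting `f` from a sequence and adding it back. -/
theorem norm_g_sub_le (f h : V) : ‖F.g f - F.g h‖ ≤ ‖F.g (f - h)‖ := by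
  refine norm_le_norm_of_abs_le_abs ?_
  rw [abs_of_nonneg (F.g_nonneg (f - h))]
  exact F.abs_g_sub_le f h

theorem g_convexComb_le {a b : ℝ} (ha : 0 ≤ a) (hb : 0 ≤ b) (v w : V) :
    F.g (a • v + b • w) ≤ a • F.g v + b • F.g w := by
  refine (F.g_add_le _ _).trans (le_of_eq ?_)
  rw [F.g_smul, F.g_smul, abs_of_nonneg ha, abs_of_nonneg hb]

/-- Subadditivity and homogeneity make `w ↦ ‖F.g w‖` a seminorm. The convexity of its sublevel sets
is what lets energy bounds survive the passage to convex combinations. -/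
theorem convex_norm_g_le (C : ℝ) : Convex ℝ {w : V | ‖F.g w‖ ≤ C} := by
  intro v hv w hw a b ha hb hab
  calc ‖F.g (a • v + b • w)‖ ≤ ‖a • F.g v + b • F.g w‖ :=
        Lp_norm_mono (F.g_nonneg _) (F.g_convexComb_le ha hb v w)
    _ ≤ a * ‖F.g v‖ + b * ‖F.g w‖ := by
        refine (norm_add_le _ _).trans_eq ?_
        rw [norm_smul, norm_smul, Real.norm_of_nonneg ha, Real.norm_of_nonneg hb]
    _ ≤ a * C + b * C :=
        add_le_add (mul_le_mul_of_nonneg_left hv ha) (mul_le_mul_of_nonneg_left hw hb)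
    _ = C := by rw [← add_mul, hab, one_mul]

/-- Along a decreasing sequence of convex sets, sequences of asymptotically minimal norm have
convergent images. -/
theorem cauchySeq_g_of_minimizing (hp1 : 1 < p) (hp : p ≠ ∞) {T : ℕ → Set V} (hT : Antitone T)
    (hTc : ∀ n, Convex ℝ (T n)) {b : ℕ → ℝ} {c : ℝ} (hb0 : ∀ n, 0 ≤ b n)
    (hb : Tendsto b atTop (𝓝 c)) (hbT : ∀ n, ∀ w ∈ T n, b n ≤ ‖F.g w‖) {w : ℕ → V}
    (hw : ∀ n, w n ∈ T n) (hwc : Tendsto (fun n => ‖F.g (w n)‖) atTop (𝓝 c)) :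
    CauchySeq fun n => F.g (w n) := by
  refine Lp_cauchySeq_of_midpoint hp1 hp (fun n => F.g_nonneg _) hwc hb0 hb fun n k hnk => ?_
  -- As `T` decreases, the midpoint stays in `T n` and its norm is at least `b n`. Midpoints thus do
  -- not lose norm in the limit, and uniform convexity forces the Cauchy property.
  have hmem : (2⁻¹ : ℝ) • w n + (2⁻¹ : ℝ) • w k ∈ T n :=
    hTc n (hw n) (hT hnk (hw k)) (by norm_num) (by norm_num) (by norm_num)
  refine (hbT n _ hmem).trans (Lp_norm_mono (F.g_nonneg _) ?_)
  rw [smul_add]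
  exact F.g_convexComb_le (by norm_num) (by norm_num) _ _

/-- Bounded sequences have convex combinations all of whose further convex combinations have
the same strong limit. -/
theorem exists_stable_convex (hp1 : 1 < p) (hp : p ≠ ∞) {u : ℕ → V} {C : ℝ}
    (hC : ∀ n, ‖F.g (u n)‖ ≤ C) :
    ∃ (h : ℕ → V) (G : Lp ℝ p m), (∀ n, h n ∈ convexHull ℝ (u '' Ici n)) ∧
      ∀ w : ℕ → V, (∀ n, w n ∈ convexHull ℝ (h '' Ici n)) →
        Tendsto (fun n => F.g (w n)) atTop (𝓝 G) := by
  set T : ℕ → Set V := fun n => convexHull ℝ (u '' Ici n)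
  have hT : Antitone T := fun n k hnk => convexHull_mono (image_mono (Ici_subset_Ici.2 hnk))
  have hTc : ∀ n, Convex ℝ (T n) := fun n => convex_convexHull ℝ _
  set S : ℕ → Set ℝ := fun n => (fun w => ‖F.g w‖) '' T n
  set b : ℕ → ℝ := fun n => sInf (S n)
  have hbdd : ∀ n, BddBelow (S n) := fun n => ⟨0, by rintro _ ⟨w, -, rfl⟩; positivity⟩
  have huT : ∀ n, u n ∈ T n := fun n => subset_convexHull ℝ _ ⟨n, self_mem_Ici, rfl⟩
  have hne : ∀ n, (S n).Nonempty := fun n => ⟨_, u n, huT n, rfl⟩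
  have hb0 : ∀ n, 0 ≤ b n := fun n => le_csInf (hne n) (by rintro _ ⟨w, -, rfl⟩; positivity)
  have hbT : ∀ n, ∀ w ∈ T n, b n ≤ ‖F.g w‖ := fun n w hw => csInf_le (hbdd n) ⟨w, hw, rfl⟩
  have hbC : ∀ n, b n ≤ C := fun n => (hbT n _ (huT n)).trans (hC n)
  have hmono : Monotone b := fun n k hnk => csInf_le_csInf (hbdd n) (hne k) (image_mono (hT hnk))
  have hBA : BddAbove (range b) := ⟨C, by rintro _ ⟨n, rfl⟩; exact hbC n⟩
  set c := ⨆ n, b n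
  have hlim : Tendsto b atTop (𝓝 c) := tendsto_atTop_ciSup hmono hBA
  have hbc : ∀ n, b n ≤ c := le_ciSup hBA
  -- The bound uses the limit `c` rather than `b n`: it then decreases in `n`, so the bound at `n`
  -- holds along the whole tail of `h`, and by convexity for all convex combinations of this tail.
  have hex : ∀ n : ℕ, ∃ w ∈ T n, ‖F.g w‖ ≤ c + 1 / ((n : ℝ) + 1) := by
    intro n
    have hpos : (0 : ℝ) < 1 / ((n : ℝ) + 1) := by positivity
    obtain ⟨_, ⟨w, hw, rfl⟩, hlt⟩ := exists_lt_of_csInf_lt (hne n)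
      (show sInf (S n) < b n + 1 / ((n : ℝ) + 1) by linarith)
    exact ⟨w, hw, by linarith [hbc n]⟩
  choose h hh hle using hex
  have hup : Tendsto (fun n : ℕ => c + 1 / ((n : ℝ) + 1)) atTop (𝓝 c) := by
    simpa using (tendsto_const_nhds (x := c)).add tendsto_one_div_add_atTop_nhds_zero_nat
  have key : ∀ w : ℕ → V, (∀ n, w n ∈ convexHull ℝ (h '' Ici n)) →
      (∀ n, w n ∈ T n) ∧ Tendsto (fun n => ‖F.g (w n)‖) atTop (𝓝 c) := by
    intro w hw
    have hwT : ∀ n, w n ∈ T n := fun n => convexHull_min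
      (by rintro _ ⟨k, hk, rfl⟩; exact hT hk (hh k)) (hTc n) (hw n)
    refine ⟨hwT, tendsto_of_tendsto_of_tendsto_of_le_of_le hlim hup
      (fun n => hbT n _ (hwT n)) fun n => ?_⟩
    refine convexHull_min (t := {v | ‖F.g v‖ ≤ c + 1 / ((n : ℝ) + 1)}) ?_
      (F.convex_norm_g_le _) (hw n)
    rintro _ ⟨k, hk, rfl⟩
    have := Nat.one_div_le_one_div (α := ℝ) (mem_Ici.1 hk)
    exact (hle k).trans (by linarith)
  obtain ⟨hhT, hhc⟩ := key h fun n => subset_convexHull ℝ _ ⟨n, self_mem_Ici, rfl⟩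
  obtain ⟨G, hG⟩ := cauchySeq_tendsto_of_complete
    (F.cauchySeq_g_of_minimizing hp1 hp hT hTc hb0 hlim hbT hhT hhc)
  refine ⟨h, G, hh, fun w hw => ?_⟩
  obtain ⟨hwT, hwc⟩ := key w hw
  have hdiv : Tendsto (fun n : ℕ => n / 2) atTop atTop :=
    Nat.tendsto_div_const_atTop two_ne_zero
  -- To see that `w` and `h` give the same limit, interleave them: the interleaved sequence is again
  -- minimizing for the sets `T (n / 2)`, so it is Cauchy under `g` and its even and odd parts share
  -- a limit.
  set z : ℕ → V := fun n => if Even n then w (n / 2) else h (n / 2)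
  have hz : CauchySeq fun n => F.g (z n) := by
    refine F.cauchySeq_g_of_minimizing hp1 hp (T := fun n => T (n / 2))
      (fun n k hnk => hT (Nat.div_le_div_right hnk)) (fun n => hTc _) (b := fun n => b (n / 2))
      (fun n => hb0 _) (hlim.comp hdiv) (fun n => hbT _) (fun n => ?_) (c := c) ?_
    · by_cases hn : Even n
      · simpa only [z, if_pos hn] using hwT (n / 2)
      · simpa only [z, if_neg hn] using hhT (n / 2)
    · have := Tendsto.if' (p := fun n : ℕ => Even n) (hwc.comp hdiv) (hhc.comp hdiv)
      refine this.congr fun n => ?_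
      by_cases hn : Even n <;> simp [z, hn]
  obtain ⟨G', hG'⟩ := cauchySeq_tendsto_of_complete hz
  have h2 : StrictMono fun n : ℕ => 2 * n := strictMono_mul_left_of_pos two_pos
  have h3 : StrictMono fun n : ℕ => 2 * n + 1 := fun a b hab => by simpa using hab
  have hw' : Tendsto (fun n => F.g (w n)) atTop (𝓝 G') := by
    refine (hG'.comp h2.tendsto_atTop).congr fun n => ?_
    simp [z]
  have hh' : Tendsto (fun n => F.g (h n)) atTop (𝓝 G') := by
    refine (hG'.comp h3.tendsto_atTop).congr fun n => ?_
    have h4 : (2 * n + 1) / 2 = n := by omega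
    simp [z, h4]
  rwa [tendsto_nhds_unique hG hh']

/-! ### Consequences of the vanishing of strong upper relaxations at `0` -/

/-- The only place where the hypothesis on strong upper relaxations is used directly. It improves a
mere energy bound to strong convergence of `g` to the right limit, at the price of convex
combinations. -/
theorem exists_convex_tendsto_g [SigmaFinite m] (hp1 : 1 < p) (hp : p ≠ ∞)
    (H : ∀ G : Lp ℝ p m, F.IsStrongUpperRelaxation 0 G → G = 0)
    {u : ℕ → V} {f : V} (hu : F.ConvergesTo u (F.toL0 f)) {C : ℝ}
    (hC : ∀ n, ‖F.g (u n)‖ ≤ C) :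
    ∃ v : ℕ → V, (∀ n, v n ∈ convexHull ℝ (u '' Ici n)) ∧
      Tendsto (fun n => F.g (v n)) atTop (𝓝 (F.g f)) := by
  obtain ⟨ns, hns, hae⟩ := hu.exists_subseq_ae
  have hae' : ∀ᵐ x ∂m, Tendsto (fun n => F.toL0 (u (ns n) - f) x) atTop
      (𝓝 ((0 : M →ₘ[m] ℝ) x)) := by
    have e : ∀ᵐ x ∂m, ∀ n, F.toL0 (u (ns n) - f) x = F.toL0 (u (ns n)) x - F.toL0 f x := by
      refine ae_all_iff.2 fun n => ?_
      rw [map_sub]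
      exact AEEqFun.coeFn_sub _ _
    filter_upwards [hae, e, AEEqFun.coeFn_zero (α := M) (μ := m) (β := ℝ)] with x h1 h2 h3
    simp only [h2, h3]
    simpa using h1.sub_const (F.toL0 f x)
  have hC' : ∀ n, ‖F.g (u (ns n) - f)‖ ≤ C + ‖F.g f‖ := fun n => by
    have h1 := norm_add_le (F.g (u (ns n) - f) - F.g (u (ns n))) (F.g (u (ns n)))
    have h2 := F.norm_g_sub_le (u (ns n) - f) (u (ns n))
    rw [sub_add_cancel] at h1
    rw [sub_sub_cancel_left, g_neg] at h2
    linarith [hC (ns n)]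
  obtain ⟨h, G, hh, hG⟩ := F.exists_stable_convex hp1 hp hC'
  have hlim := hG h fun n => subset_convexHull ℝ _ ⟨n, self_mem_Ici, rfl⟩
  have hconv : F.ConvergesTo h 0 := tendstoL0_of_ae (F.ae_tendsto_of_convexHull hae' hh)
  -- The same sequence `h` witnesses both halves of the definition: constant choice of combinations
  -- gives the weak limit, and stability gives the strong limits.
  have hG0 : G = 0 := H G ⟨⟨h, G, hconv, weak_of_strong hlim, le_rfl⟩, h, hconv, hG⟩
  refine ⟨fun n => h n + f, fun n => ?_, ?_⟩
  · refine convexHull_min (t := {w | w + f ∈ convexHull ℝ (u '' Ici n)}) ?_ ?_ (hh n)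
    · rintro _ ⟨k, hk, rfl⟩
      rw [mem_ofPred_eq, sub_add_cancel]
      -- Since `ns k ≥ k`, tails of the subsequence lie in the tails of `u` with the same index.
      exact subset_convexHull ℝ _ ⟨ns k, (mem_Ici.1 hk).trans (hns.le_apply), rfl⟩
    · exact (convex_convexHull ℝ (u '' Ici n)).translate_preimage_left f
  · rw [tendsto_iff_norm_sub_tendsto_zero]
    refine squeeze_zero (fun n => norm_nonneg _) (fun n => F.norm_g_sub_le _ _) ?_
    simpa [hG0] using hlim.norm

/-- Lower semicontinuity in the form used below. A bound for infinitely many `n` is a bound along a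
subsequence, hence on its convex combinations, hence on the strong limit `F.g f`. -/
theorem norm_g_le_of_frequently [SigmaFinite m] (hp1 : 1 < p) (hp : p ≠ ∞)
    (H : ∀ G : Lp ℝ p m, F.IsStrongUpperRelaxation 0 G → G = 0)
    {u : ℕ → V} {f : V} (hu : F.ConvergesTo u (F.toL0 f)) {C : ℝ}
    (hC : ∃ᶠ n in atTop, ‖F.g (u n)‖ ≤ C) : ‖F.g f‖ ≤ C := by
  obtain ⟨ns, hns, hle⟩ := extraction_of_frequently_atTop hC
  obtain ⟨v, hv, hlim⟩ := F.exists_convex_tendsto_g hp1 hp H (hu.comp hns) hle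
  refine le_of_tendsto' hlim.norm fun n => ?_
  refine convexHull_min (t := {w | ‖F.g w‖ ≤ C}) ?_ (F.convex_norm_g_le C) (hv n)
  rintro _ ⟨k, -, rfl⟩
  exact hle k

/-- Lower semicontinuity of the energy with respect to `L^0`-convergence. -/
theorem lintegral_g_le_liminf [SigmaFinite m] (hp1 : 1 < p) (hp : p ≠ ∞)
    (H : ∀ G : Lp ℝ p m, F.IsStrongUpperRelaxation 0 G → G = 0)
    {u : ℕ → V} {f : V} (hu : F.ConvergesTo u (F.toL0 f)) :
    ∫⁻ x, ‖F.g f x‖ₑ ^ p.toReal ∂m ≤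
      liminf (fun n => ∫⁻ x, ‖F.g (u n) x‖ₑ ^ p.toReal ∂m) atTop := by
  have hr : 0 < p.toReal := ENNReal.toReal_pos (zero_lt_one.trans hp1).ne' hp
  -- Any `c` above the lower limit bounds the energy for infinitely many `n`; taking `p`-th roots
  -- turns this into a bound on norms.
  refine le_of_forall_gt_imp_ge_of_dense fun c hc => ?_
  rcases eq_or_ne c ∞ with rfl | hc'
  · exact le_top
  have hfr := frequently_lt_of_liminf_lt (by isBoundedDefault) hc
  have hne : c ^ (p.toReal)⁻¹ ≠ ∞ := ENNReal.rpow_ne_top_of_nonneg (by positivity) hc'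
  have h1 : ‖F.g f‖ ≤ (c ^ (p.toReal)⁻¹).toReal := by
    refine F.norm_g_le_of_frequently hp1 hp H hu (hfr.mono fun n hn => ?_)
    rw [F.lintegral_g hp1 hp] at hn
    rw [← toReal_enorm]
    exact ENNReal.toReal_mono hne ((ENNReal.le_rpow_inv_iff hr).2 hn.le)
  rw [F.lintegral_g hp1 hp, ← ENNReal.le_rpow_inv_iff hr, ← ofReal_norm]
  exact ENNReal.ofReal_le_of_le_toReal h1

/-- Relaxation does not lower `g` on its original domain. The constant sequence gives one
inequality. For the other, if `g (u n)` converges weakly to `G`, there are convex combinations `v n`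
with `g (v n) → g f`, and `g (v n)` is dominated by convex combinations of the `g (u k)`, which
still converge weakly to `G`; weak limits respect order. -/
theorem lowerRelax_toL0 [SigmaFinite m] (hp1 : 1 < p) (hp : p ≠ ∞)
    (H : ∀ G : Lp ℝ p m, F.IsStrongUpperRelaxation 0 G → G = 0)
    (f : V) : F.lowerRelax (F.toL0 f) = F.g f := by
  have hG := F.isGreatest_lowerRelax hp1 hp (F.toRelaxDomain hp1 hp f).2
  change IsGreatest (F.lowerSet (F.toL0 f)) (F.lowerRelax (F.toL0 f)) at hG
  refine le_antisymm (hG.1 (fun _ => f) _ (tendstoL0_of_ae (by simp))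
    (weak_of_strong tendsto_const_nhds)) (hG.2 fun u G hu huG => ?_)
  obtain ⟨C, hC⟩ := weak_bounded huG
  obtain ⟨v, hv, hlim⟩ := F.exists_convex_tendsto_g hp1 hp H hu hC
  have hdom : ∀ n, ∃ W ∈ convexHull ℝ ((fun n => F.g (u n)) '' Ici n), F.g (v n) ≤ W := by
    intro n
    refine convexHull_min (t := {w | ∃ W ∈ convexHull ℝ ((fun n => F.g (u n)) '' Ici n),
      F.g w ≤ W}) ?_ ?_ (hv n)
    · rintro _ ⟨k, hk, rfl⟩
      exact ⟨_, subset_convexHull ℝ _ (mem_image_of_mem _ hk), le_rfl⟩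
    · rintro w1 ⟨W1, hW1, h1⟩ w2 ⟨W2, hW2, h2⟩ a b ha hb hab
      exact ⟨a • W1 + b • W2, convex_convexHull ℝ _ hW1 hW2 ha hb hab,
        (F.g_convexComb_le ha hb _ _).trans (add_le_add (Lp_smul_le ha h1) (Lp_smul_le hb h2))⟩
  choose W hW hWle using hdom
  exact weak_le (weak_of_strong hlim) (weak_convexHull huG hW) hWle

/-- For fixed large `n`, the differences `u n - u k` converge to `u n` in `L^0` while their energies
are small by the Cauchy property. Lower semicontinuity makes the energy of `u n` itself small, so
the differentials tend to `0`. -/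
theorem isClosable_of_strongUpperRelaxation [SigmaFinite m] (hp1 : 1 < p) (hp : p ≠ ∞)
    (H : ∀ G : Lp ℝ p m, F.IsStrongUpperRelaxation 0 G → G = 0)
    : F.IsClosable := by
  intro u ω hu hω
  have hdist : ∀ v w : V, dist (F.d v) (F.d w) = ‖F.g (v - w)‖ := by
    intro v w
    rw [d, d, UniformSpace.Completion.dist_eq, dist_eq_norm, ← map_sub]
    change ‖MemLp.toLp _ _‖ = _
    rw [← Lp.toLp_coeFn (F.g (v - w)) (Lp.memLp _)]
    rfl
  refine tendsto_nhds_unique hω ?_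
  have hcau := Metric.cauchySeq_iff.1 hω.cauchySeq
  have hd0 : F.d 0 = 0 := by
    rw [d, map_zero]; rfl
  rw [← hd0, Metric.tendsto_atTop]
  intro ε hε
  obtain ⟨N, hN⟩ := hcau (ε / 2) (half_pos hε)
  refine ⟨N, fun n hn => ?_⟩
  rw [hdist, sub_zero]
  refine lt_of_le_of_lt ?_ (half_lt_self hε)
  obtain ⟨ns, hns, hae⟩ := hu.exists_subseq_ae
  refine F.norm_g_le_of_frequently hp1 hp H (u := fun k => u n - u (ns k)) ?_ ?_
  · refine tendstoL0_of_ae ?_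
    have e : ∀ᵐ x ∂m, ∀ k, F.toL0 (u n - u (ns k)) x = F.toL0 (u n) x - F.toL0 (u (ns k)) x := by
      refine ae_all_iff.2 fun k => ?_
      rw [map_sub]
      exact AEEqFun.coeFn_sub _ _
    filter_upwards [hae, e, AEEqFun.coeFn_zero (α := M) (μ := m) (β := ℝ)] with x h1 h2 h3
    simp only [h2]
    rw [h3] at h1
    simpa using h1.const_sub (F.toL0 (u n) x)
  · refine (eventually_atTop.2 ⟨N, fun k hk => ?_⟩).frequently
    rw [← hdist]
    exact (hN n hn (ns k) (hk.trans hns.le_apply)).le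

end Closability

end LpFunctional

namespace LpFunctional

/-! ### The `L^∞`-module structure -/

section NormedModule
variable {M : Type*} [MeasurableSpace M] {m : Measure M} {p : ℝ≥0∞} [Fact (1 ≤ p)]
  {V : Type*} [AddCommGroup V] [Module ℝ V] (F : LpFunctional m p V)

/-! #### The pointwise norm -/

theorem continuous_pointwiseNorm : Continuous F.pointwiseNorm :=
  UniformSpace.Completion.continuous_extension

theorem pointwiseNorm_nonneg (v : F.LpModule) : 0 ≤ F.pointwiseNorm v := by
  induction v using UniformSpace.Completion.induction_on with
  | hp => exact isClosed_Ici.preimage F.continuous_pointwiseNorm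
  | ih s => rw [pointwiseNorm_coe]; exact s.pointwiseNorm_nonneg

theorem pointwiseNorm_add_le (v w : F.LpModule) :
    F.pointwiseNorm (v + w) ≤ F.pointwiseNorm v + F.pointwiseNorm w := by
  induction v, w using UniformSpace.Completion.induction_on₂ with
  | hp =>
    have h := F.continuous_pointwiseNorm
    exact isClosed_le (h.comp (continuous_fst.add continuous_snd))
      ((h.comp continuous_fst).add (h.comp continuous_snd))
  | ih s t =>
    rw [← UniformSpace.Completion.coe_add]
    simp only [pointwiseNorm_coe]
    exact s.pointwiseNorm_add_le t

theorem pointwiseNorm_neg (v : F.LpModule) : F.pointwiseNorm (-v) = F.pointwiseNorm v := by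
  induction v using UniformSpace.Completion.induction_on with
  | hp =>
    exact isClosed_eq (F.continuous_pointwiseNorm.comp continuous_neg)
      F.continuous_pointwiseNorm
  | ih s =>
    rw [← UniformSpace.Completion.coe_neg]
    simp only [pointwiseNorm_coe]
    have := Pfm.pointwiseNorm_smul (-1) s
    rwa [neg_smul, one_smul, abs_neg, abs_one, one_smul] at this

/-- True by definition on families, hence everywhere by density. Through it, identities and
estimates in the module reduce to a.e. statements about pointwise norms. -/
theorem norm_pointwiseNorm (v : F.LpModule) : ‖F.pointwiseNorm v‖ = ‖v‖ := by
  induction v using UniformSpace.Completion.induction_on with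
  | hp => exact isClosed_eq F.continuous_pointwiseNorm.norm continuous_norm
  | ih s => rw [pointwiseNorm_coe, UniformSpace.Completion.norm_coe, Pfm.norm_def]

theorem pointwiseNorm_sub_comm (v w : F.LpModule) :
    F.pointwiseNorm (v - w) = F.pointwiseNorm (w - v) := by
  rw [← neg_sub, pointwiseNorm_neg]

theorem ae_pointwiseNorm_nonneg (v : F.LpModule) : ∀ᵐ x ∂m, 0 ≤ F.pointwiseNorm v x :=
  (Lp.coeFn_nonneg _).2 (F.pointwiseNorm_nonneg v)

theorem ae_pointwiseNorm_add_le (v w : F.LpModule) :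
    ∀ᵐ x ∂m, F.pointwiseNorm (v + w) x ≤ F.pointwiseNorm v x + F.pointwiseNorm w x := by
  filter_upwards [(Lp.coeFn_le _ _).2 (F.pointwiseNorm_add_le v w),
    Lp.coeFn_add (F.pointwiseNorm v) (F.pointwiseNorm w)] with x h1 h2
  rwa [h2] at h1

theorem ae_pointwiseNorm_sub_le (u v w : F.LpModule) :
    ∀ᵐ x ∂m, F.pointwiseNorm (u - w) x ≤ F.pointwiseNorm (u - v) x + F.pointwiseNorm (v - w) x := by
  simpa using F.ae_pointwiseNorm_add_le (u - v) (v - w)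

theorem eq_zero_iff_pointwiseNorm (v : F.LpModule) :
    v = 0 ↔ ∀ᵐ x ∂m, F.pointwiseNorm v x = 0 := by
  rw [← norm_eq_zero, ← norm_pointwiseNorm, norm_eq_zero, Lp.eq_zero_iff_ae_eq_zero]
  rfl

/-! #### Multiplication -/

/-- A countably valued multiplier only refines the partition, so homogeneity of `g` can be applied
value by value and the formula is exact. -/
theorem Pfm.ae_pointwiseNorm_of_val {F : LpFunctional m p V} {q : M → ℝ} (hq : IsCountablyValued q)
    {s t : F.Pfm} (ht : t.val = fun x => q x • s.val x) :
    ∀ᵐ x ∂m, t.pointwiseNorm x = |q x| * s.pointwiseNorm x := by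
  filter_upwards [s.coeFn_pointwiseNorm, t.coeFn_pointwiseNorm, F.pointwise_smul hq s.2.1]
    with x h1 h2 h3
  rw [h1, h2, ht]
  exact h3

theorem Pfm.norm_le_of_val {F : LpFunctional m p V} {q : M → ℝ} (hq : IsCountablyValued q)
    {s t : F.Pfm} (ht : t.val = fun x => q x • s.val x) {C : ℝ} (hC : ∀ᵐ x ∂m, |q x| ≤ C) :
    ‖t‖ ≤ C * ‖s‖ := by
  rw [Pfm.norm_def, Pfm.norm_def]
  refine Lp.norm_le_mul_norm_of_ae_le_mul ?_
  filter_upwards [Pfm.ae_pointwiseNorm_of_val hq ht, hC] with x h1 h2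
  rw [h1, norm_mul, Real.norm_eq_abs, abs_abs]
  exact mul_le_mul_of_nonneg_right h2 (norm_nonneg _)

theorem isCountablyValued_approx_coeFn (a : Lp ℝ ∞ m) (n : ℕ) : IsCountablyValued (approx a n) :=
  isCountablyValued_approx (Lp.stronglyMeasurable a).measurable n

theorem approxMul_val (a : Lp ℝ ∞ m) (n : ℕ) (s : F.Pfm) :
    (F.approxMul a n s).val = fun x => approx a n x • s.val x := rfl

theorem continuous_map_approxMul (a : Lp ℝ ∞ m) (n : ℕ) :
    Continuous (UniformSpace.Completion.map (F.approxMul a n)) :=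
  UniformSpace.Completion.continuous_map

theorem map_approxMul_coe (a : Lp ℝ ∞ m) (n : ℕ) (s : F.Pfm) :
    UniformSpace.Completion.map (F.approxMul a n) (s : F.LpModule) = (F.approxMul a n s : F.Pfm) :=
  UniformSpace.Completion.map_coe (F.uniformContinuous_approxMul a n) s

theorem linftyMul_add (a : Lp ℝ ∞ m) (v w : F.LpModule) :
    F.linftyMul a (v + w) = F.linftyMul a v + F.linftyMul a w := by
  refine tendsto_nhds_unique (F.tendsto_linftyMul a (v + w))
    (((F.tendsto_linftyMul a v).add (F.tendsto_linftyMul a w)).congr fun n => Eq.symm ?_)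
  have hc := F.continuous_map_approxMul a n
  induction v, w using UniformSpace.Completion.induction_on₂ with
  | hp =>
    exact isClosed_eq (hc.comp (continuous_fst.add continuous_snd))
      ((hc.comp continuous_fst).add (hc.comp continuous_snd))
  | ih s t =>
    rw [← UniformSpace.Completion.coe_add]
    simp only [map_approxMul_coe]
    rw [map_add, UniformSpace.Completion.coe_add]

theorem linftyMul_smul (c : ℝ) (a : Lp ℝ ∞ m) (v : F.LpModule) :
    F.linftyMul a (c • v) = c • F.linftyMul a v := by
  refine tendsto_nhds_unique (F.tendsto_linftyMul a (c • v))
    (((F.tendsto_linftyMul a v).const_smul c).congr fun n => Eq.symm ?_)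
  have hc := F.continuous_map_approxMul a n
  induction v using UniformSpace.Completion.induction_on with
  | hp => exact isClosed_eq (hc.comp (continuous_const_smul c)) (hc.const_smul c)
  | ih s =>
    rw [← UniformSpace.Completion.coe_smul]
    simp only [map_approxMul_coe]
    rw [map_smul, UniformSpace.Completion.coe_smul]

/-- The constant is not sharp: the `1` absorbs the error of the countably valued approximations.
Only continuity in `v` is needed from it. -/
theorem norm_linftyMul_le (a : Lp ℝ ∞ m) (v : F.LpModule) :
    ‖F.linftyMul a v‖ ≤ (‖a‖ + 1) * ‖v‖ := by
  refine le_of_tendsto' (F.tendsto_linftyMul a v).norm fun n => ?_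
  have hc := F.continuous_map_approxMul a n
  induction v using UniformSpace.Completion.induction_on with
  | hp => exact isClosed_le hc.norm (continuous_const.mul continuous_norm)
  | ih s =>
    rw [map_approxMul_coe, UniformSpace.Completion.norm_coe, UniformSpace.Completion.norm_coe]
    exact F.norm_approxMul_le a n s

/-- Multiplication by `a` as a continuous linear map. -/
noncomputable def linftyMulL (a : Lp ℝ ∞ m) : F.LpModule →L[ℝ] F.LpModule :=
  LinearMap.mkContinuous
    { toFun := F.linftyMul a
      map_add' := F.linftyMul_add a
      map_smul' := fun c v => F.linftyMul_smul c a v } (‖a‖ + 1) (F.norm_linftyMul_le a)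

theorem continuous_linftyMul (a : Lp ℝ ∞ m) : Continuous (F.linftyMul a) :=
  (F.linftyMulL a).continuous

theorem linftyMul_sub (a : Lp ℝ ∞ m) (v w : F.LpModule) :
    F.linftyMul a (v - w) = F.linftyMul a v - F.linftyMul a w :=
  map_sub (F.linftyMulL a) v w

/-- Frees multiplication from the particular approximations in its definition: any countably valued
`q` uniformly close to `a` gives nearly the same product. The proof compares `q` with `approx a n`,
at distance at most `δ + 1 / (n + 1)`, and lets `n → ∞`. -/
theorem norm_linftyMul_coe_sub_le (a : Lp ℝ ∞ m) {q : M → ℝ} (hq : IsCountablyValued q)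
    {s t : F.Pfm} (ht : t.val = fun x => q x • s.val x) {δ : ℝ}
    (hδ : ∀ᵐ x ∂m, |q x - a x| ≤ δ) :
    ‖(t : F.LpModule) - F.linftyMul a s‖ ≤ δ * ‖s‖ := by
  have h1 : Tendsto (fun n : ℕ => (δ + 1 / ((n : ℝ) + 1)) * ‖s‖) atTop (𝓝 (δ * ‖s‖)) := by
    simpa using (tendsto_one_div_add_atTop_nhds_zero_nat.const_add δ).mul_const ‖s‖
  refine le_of_tendsto_of_tendsto' ((F.tendsto_linftyMul a s).const_sub _).norm h1 fun n => ?_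
  rw [map_approxMul_coe, ← UniformSpace.Completion.coe_sub, UniformSpace.Completion.norm_coe]
  refine Pfm.norm_le_of_val (q := fun x => q x - approx a n x)
    (hq.comp₂ (isCountablyValued_approx_coeFn a n) (· - ·)) ?_ ?_
  · funext x
    rw [sub_smul, ← congrFun ht x]
    rfl
  · filter_upwards [hδ] with x hx
    have h2 := abs_approx_sub_le a n x
    rw [abs_le] at *
    constructor <;> linarith

/-- Algebraic identities for the multiplication follow by applying this to sums, multiples or
products of approximations, and using uniqueness of limits. -/
theorem tendsto_of_val (a : Lp ℝ ∞ m) {q : ℕ → M → ℝ} (hq : ∀ n, IsCountablyValued (q n))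
    {s : F.Pfm} {t : ℕ → F.Pfm} (ht : ∀ n, (t n).val = fun x => q n x • s.val x) {C : ℝ}
    (hC : ∀ n : ℕ, ∀ᵐ x ∂m, |q n x - a x| ≤ C * (1 / ((n : ℝ) + 1))) :
    Tendsto (fun n => (t n : F.LpModule)) atTop (𝓝 (F.linftyMul a s)) := by
  rw [tendsto_iff_norm_sub_tendsto_zero]
  refine squeeze_zero (fun n => norm_nonneg _)
    (fun n => F.norm_linftyMul_coe_sub_le a (hq n) (ht n) (hC n)) ?_
  simpa using ((tendsto_one_div_add_atTop_nhds_zero_nat (𝕜 := ℝ)).const_mul C).mul_const ‖s‖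

theorem tendsto_approxMul_coe (a : Lp ℝ ∞ m) (s : F.Pfm) :
    Tendsto (fun n => ((F.approxMul a n s : F.Pfm) : F.LpModule)) atTop
      (𝓝 (F.linftyMul a s)) := by
  simpa only [map_approxMul_coe] using F.tendsto_linftyMul a s

theorem add_linftyMul (a b : Lp ℝ ∞ m) (v : F.LpModule) :
    F.linftyMul (a + b) v = F.linftyMul a v + F.linftyMul b v := by
  induction v using UniformSpace.Completion.induction_on with
  | hp =>
    exact isClosed_eq (F.continuous_linftyMul _)
      ((F.continuous_linftyMul a).add (F.continuous_linftyMul b))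
  | ih s =>
    refine tendsto_nhds_unique (F.tendsto_of_val (a + b)
      (q := fun n x => approx a n x + approx b n x) (t := fun n => F.approxMul a n s +
        F.approxMul b n s) (C := 2) (fun n => (isCountablyValued_approx_coeFn a n).comp₂
        (isCountablyValued_approx_coeFn b n) (· + ·)) (fun n => ?_) fun n => ?_)
      (((F.tendsto_approxMul_coe a s).add (F.tendsto_approxMul_coe b s)).congr fun n => ?_)
    · funext x
      exact (add_smul _ _ _).symm
    · filter_upwards [Lp.coeFn_add a b] with x hx
      have h1 := abs_approx_sub_le a n x
      have h2 := abs_approx_sub_le b n x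
      rw [hx, Pi.add_apply]
      rw [abs_le] at *
      constructor <;> linarith
    · exact (UniformSpace.Completion.coe_add _ _).symm

theorem smul_linftyMul (c : ℝ) (a : Lp ℝ ∞ m) (v : F.LpModule) :
    F.linftyMul (c • a) v = c • F.linftyMul a v := by
  induction v using UniformSpace.Completion.induction_on with
  | hp => exact isClosed_eq (F.continuous_linftyMul _) ((F.continuous_linftyMul a).const_smul c)
  | ih s =>
    refine tendsto_nhds_unique (F.tendsto_of_val (c • a)
      (q := fun n x => c * approx a n x) (t := fun n => c • F.approxMul a n s)
      (C := |c|) (fun n => (isCountablyValued_const c).comp₂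
        (isCountablyValued_approx_coeFn a n) (· * ·)) (fun n => ?_) fun n => ?_)
      (((F.tendsto_approxMul_coe a s).const_smul c).congr fun n => ?_)
    · funext x
      exact (mul_smul _ _ _).symm
    · filter_upwards [Lp.coeFn_smul c a] with x hx
      rw [hx, Pi.smul_apply, smul_eq_mul, ← mul_sub, abs_mul]
      exact mul_le_mul_of_nonneg_left (abs_approx_sub_le a n x) (abs_nonneg c)
    · exact (UniformSpace.Completion.coe_smul _ _).symm

theorem mul_linftyMul (a b : Lp ℝ ∞ m) (v : F.LpModule) :
    F.linftyMul (a • b : Lp ℝ ∞ m) v = F.linftyMul a (F.linftyMul b v) := by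
  induction v using UniformSpace.Completion.induction_on with
  | hp =>
    exact isClosed_eq (F.continuous_linftyMul _)
      ((F.continuous_linftyMul a).comp (F.continuous_linftyMul b))
  | ih s =>
    have h0 := tendsto_one_div_add_atTop_nhds_zero_nat (𝕜 := ℝ)
    have h1 : Tendsto (fun n => F.linftyMul a ((F.approxMul b n s : F.Pfm) : F.LpModule)) atTop
        (𝓝 (F.linftyMul a (F.linftyMul b s))) :=
      ((F.continuous_linftyMul a).tendsto _).comp (F.tendsto_approxMul_coe b s)
    -- The inner factor also varies with `n`, so the diagonal sequence is compared with exact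
    -- multiplication by `a`; the error is uniform because `F.approxMul b n s` stays bounded.
    have h2 : Tendsto (fun n => ((F.approxMul a n (F.approxMul b n s) : F.Pfm) : F.LpModule) -
        F.linftyMul a ((F.approxMul b n s : F.Pfm) : F.LpModule)) atTop (𝓝 0) := by
      rw [tendsto_zero_iff_norm_tendsto_zero]
      refine squeeze_zero (fun n => norm_nonneg _)
        (g := fun n : ℕ => (1 / ((n : ℝ) + 1)) * ((‖b‖ + 1) * ‖s‖)) (fun n => ?_) ?_
      · refine (F.norm_linftyMul_coe_sub_le a (isCountablyValued_approx_coeFn a n)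
          (F.approxMul_val a n _) (ae_of_all _ (abs_approx_sub_le a n))).trans ?_
        exact mul_le_mul_of_nonneg_left (F.norm_approxMul_le b n s) (by positivity)
      · simpa using h0.mul_const ((‖b‖ + 1) * ‖s‖)
    have h3 := h2.add h1
    simp only [sub_add_cancel, zero_add] at h3
    refine tendsto_nhds_unique (F.tendsto_of_val (a • b : Lp ℝ ∞ m)
      (q := fun n x => approx a n x * approx b n x) (C := ‖a‖ + 1 + ‖b‖)
      (fun n => (isCountablyValued_approx_coeFn a n).comp₂ (isCountablyValued_approx_coeFn b n)
        (· * ·)) (fun n => ?_) fun n => ?_) h3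
    · funext x
      exact (mul_smul _ _ _).symm
    · filter_upwards [Lp.coeFn_lpSMul (r := ∞) a b, ae_abs_le a, ae_abs_le b] with x hx ha hb
      rw [hx, Pi.smul_apply', smul_eq_mul]
      have h4 := abs_approx_sub_le a n x
      have h5 := abs_approx_sub_le b n x
      have h6 : 1 / ((n : ℝ) + 1) ≤ 1 := by
        rw [div_le_one (by positivity)]; linarith [(Nat.cast_nonneg n : (0 : ℝ) ≤ n)]
      have h7 := abs_sub_abs_le_abs_sub (approx a n x) (a x)
      -- The product error splits in the usual way; `|approx a n|` is at most `‖a‖ + 1` and `|b|` at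
      -- most `‖b‖`, which is the origin of the constant `‖a‖ + 1 + ‖b‖`.
      have e : approx a n x * approx b n x - a x * b x =
          approx a n x * (approx b n x - b x) + (approx a n x - a x) * b x := by ring
      rw [e]
      refine (abs_add_le _ _).trans ?_
      rw [abs_mul, abs_mul, add_mul]
      refine add_le_add (mul_le_mul (by linarith) h5 (abs_nonneg _) (by positivity)) ?_
      rw [mul_comm]
      exact mul_le_mul hb h4 (abs_nonneg _) (norm_nonneg b)

/-! ### Characteristic functions and locality -/

theorem coeFn_chi {A : Set M} (hA : MeasurableSet A) :
    chi m hA =ᵐ[m] A.indicator fun _ => (1 : ℝ) := MemLp.coeFn_toLp _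

theorem linftyMul_chi_univ (v : F.LpModule) : F.linftyMul (chi m MeasurableSet.univ) v = v := by
  induction v using UniformSpace.Completion.induction_on with
  | hp => exact isClosed_eq (F.continuous_linftyMul _) continuous_id
  | ih s =>
    refine tendsto_nhds_unique (F.tendsto_of_val (chi m MeasurableSet.univ)
      (q := fun _ _ => 1) (t := fun _ => s) (C := 0) (fun n => isCountablyValued_const 1)
      (fun n => ?_) fun n => ?_) tendsto_const_nhds
    · funext x
      exact (one_smul _ _).symm
    · filter_upwards [coeFn_chi (m := m) MeasurableSet.univ] with x hx
      simp [hx]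

theorem continuous_lpSMul (a : Lp ℝ ∞ m) : Continuous fun w : Lp ℝ p m => (a • w : Lp ℝ p m) := by
  refine LipschitzWith.continuous (K := ‖a‖₊) (LipschitzWith.of_dist_le_mul fun v w => ?_)
  rw [dist_eq_norm, dist_eq_norm, coe_nnnorm]
  refine Lp.norm_le_mul_norm_of_ae_le_mul ?_
  filter_upwards [Lp.coeFn_lpSMul (r := p) a v, Lp.coeFn_lpSMul (r := p) a w, Lp.coeFn_sub v w,
    Lp.coeFn_sub (a • v : Lp ℝ p m) (a • w : Lp ℝ p m), ae_abs_le a] with x h1 h2 h3 h4 h5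
  rw [h4, h3, Pi.sub_apply, Pi.sub_apply, h1, h2, Pi.smul_apply', Pi.smul_apply', ← smul_sub,
    norm_smul]
  exact mul_le_mul_of_nonneg_right h5 (norm_nonneg _)

/-- On families the formula holds exactly for each approximation of `a`, with error at most `1 / (n
+ 1)` times the pointwise norm when `|approx a n|` is replaced by `|a|`. -/
theorem pointwiseNorm_linftyMul (a : Lp ℝ ∞ m) (v : F.LpModule) :
    F.pointwiseNorm (F.linftyMul a v) = (|a| • F.pointwiseNorm v : Lp ℝ p m) := by
  induction v using UniformSpace.Completion.induction_on with
  | hp =>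
    exact isClosed_eq (F.continuous_pointwiseNorm.comp (F.continuous_linftyMul a))
      ((continuous_lpSMul |a|).comp F.continuous_pointwiseNorm)
  | ih s =>
    rw [pointwiseNorm_coe]
    refine tendsto_nhds_unique
      ((F.continuous_pointwiseNorm.tendsto _).comp (F.tendsto_approxMul_coe a s)) ?_
    rw [tendsto_iff_norm_sub_tendsto_zero]
    refine squeeze_zero (fun n => norm_nonneg _)
      (g := fun n : ℕ => (1 / ((n : ℝ) + 1)) * ‖s.pointwiseNorm‖) (fun n => ?_)
      (by simpa using (tendsto_one_div_add_atTop_nhds_zero_nat (𝕜 := ℝ)).mul_const _)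
    rw [Function.comp_apply, pointwiseNorm_coe]
    refine Lp.norm_le_mul_norm_of_ae_le_mul ?_
    filter_upwards [Lp.coeFn_lpSMul (r := p) |a| s.pointwiseNorm, Lp.coeFn_abs a,
      Lp.coeFn_sub (F.approxMul a n s).pointwiseNorm (|a| • s.pointwiseNorm : Lp ℝ p m),
      Pfm.ae_pointwiseNorm_of_val (isCountablyValued_approx_coeFn a n) (F.approxMul_val a n s)]
      with x h1 h2 h3 h4
    rw [h3, Pi.sub_apply, h1, h4, Pi.smul_apply', h2, smul_eq_mul, ← sub_mul, norm_mul]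
    refine mul_le_mul_of_nonneg_right ?_ (norm_nonneg _)
    exact (abs_abs_sub_abs_le_abs_sub _ _).trans (abs_approx_sub_le a n x)

theorem ae_pointwiseNorm_linftyMul (a : Lp ℝ ∞ m) (v : F.LpModule) :
    ∀ᵐ x ∂m, F.pointwiseNorm (F.linftyMul a v) x = |a x| * F.pointwiseNorm v x := by
  rw [pointwiseNorm_linftyMul]
  filter_upwards [Lp.coeFn_lpSMul (r := p) |a| (F.pointwiseNorm v), Lp.coeFn_abs a] with x h1 h2
  rw [h1, Pi.smul_apply', h2, smul_eq_mul]

theorem ae_pointwiseNorm_chi_mul {A : Set M} (hA : MeasurableSet A) (v : F.LpModule) :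
    ∀ᵐ x ∂m, F.pointwiseNorm (F.linftyMul (chi m hA) v) x = A.indicator (F.pointwiseNorm v) x := by
  filter_upwards [F.ae_pointwiseNorm_linftyMul (chi m hA) v, coeFn_chi hA] with x h1 h2
  rw [h1, h2]
  by_cases hx : x ∈ A <;> simp [hx]

theorem ae_pointwiseNorm_chi_mul_sub {A : Set M} (hA : MeasurableSet A) (v : F.LpModule) :
    ∀ᵐ x ∂m, F.pointwiseNorm (F.linftyMul (chi m hA) v - v) x =
      Aᶜ.indicator (F.pointwiseNorm v) x := by
  -- The difference is multiplication by `χ_A - 1`, whose absolute value is the characteristic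
  -- function of the complement.
  have e : F.linftyMul (chi m hA) v - v =
      F.linftyMul (chi m hA + (-1 : ℝ) • chi m MeasurableSet.univ) v := by
    rw [add_linftyMul, smul_linftyMul, linftyMul_chi_univ, neg_smul, one_smul, sub_eq_add_neg]
  rw [e]
  filter_upwards [F.ae_pointwiseNorm_linftyMul (chi m hA + (-1 : ℝ) • chi m MeasurableSet.univ) v,
    coeFn_chi hA, coeFn_chi MeasurableSet.univ,
    Lp.coeFn_add (chi m hA) ((-1 : ℝ) • chi m MeasurableSet.univ),
    Lp.coeFn_smul (-1 : ℝ) (chi m MeasurableSet.univ)] with x h1 h2 h3 h4 h5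
  rw [h1, h4, Pi.add_apply, h5, Pi.smul_apply, h2, h3]
  by_cases hx : x ∈ A <;> simp [hx]

/-- Translates vanishing on a set into an a.e. condition on the pointwise norm; locality and glueing
are then arguments about points. -/
theorem chi_mul_eq_zero_iff {A : Set M} (hA : MeasurableSet A) (v : F.LpModule) :
    F.linftyMul (chi m hA) v = 0 ↔ ∀ᵐ x ∂m, x ∈ A → F.pointwiseNorm v x = 0 := by
  rw [eq_zero_iff_pointwiseNorm]
  refine eventually_congr ?_
  filter_upwards [F.ae_pointwiseNorm_chi_mul hA v] with x hx
  rw [hx]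
  by_cases h : x ∈ A <;> simp [h]

theorem chi_mul_eq_iff {A : Set M} (hA : MeasurableSet A) (v w : F.LpModule) :
    F.linftyMul (chi m hA) v = F.linftyMul (chi m hA) w ↔
      ∀ᵐ x ∂m, x ∈ A → F.pointwiseNorm (v - w) x = 0 := by
  rw [← sub_eq_zero, ← linftyMul_sub, chi_mul_eq_zero_iff]

theorem chi_mul_iUnion_eq_zero {v : F.LpModule} {A : ℕ → Set M} (hA : ∀ n, MeasurableSet (A n))
    (h : ∀ n, F.linftyMul (chi m (hA n)) v = 0) :
    F.linftyMul (chi m (MeasurableSet.iUnion hA)) v = 0 := by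
  rw [chi_mul_eq_zero_iff]
  filter_upwards [ae_all_iff.2 fun n => (F.chi_mul_eq_zero_iff (hA n) v).1 (h n)] with x hx hxA
  obtain ⟨n, hn⟩ := mem_iUnion.1 hxA
  exact hx n hn

end NormedModule

end LpFunctional

namespace LpFunctional

/-! ### Generation by differentials, and glueing -/

section Generation
variable {M : Type*} [MeasurableSpace M] {m : Measure M} {p : ℝ≥0∞} [Fact (1 ≤ p)]
  {V : Type*} [AddCommGroup V] [Module ℝ V] (F : LpFunctional m p V)

/-- Dominated convergence: the pointwise norm of the error is that of `v` cut off to the complement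
of `A n`, and these complements decrease to the empty set. This replaces countable sums by finite
ones. -/
theorem tendsto_chi_mul (hp1 : 1 < p) (hp : p ≠ ∞) {A : ℕ → Set M}
    (hA : ∀ n, MeasurableSet (A n)) (hmono : Monotone A) (hU : ⋃ n, A n = univ) (v : F.LpModule) :
    Tendsto (fun n => F.linftyMul (chi m (hA n)) v) atTop (𝓝 v) := by
  have hp0 : p ≠ 0 := (zero_lt_one.trans hp1).ne'
  have hr : 0 < p.toReal := ENNReal.toReal_pos hp0 hp
  have h1 : Tendsto (fun n => ‖F.linftyMul (chi m (hA n)) v - v‖ ^ p.toReal) atTop (𝓝 0) := by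
    have h2 : ∀ n, ‖F.linftyMul (chi m (hA n)) v - v‖ ^ p.toReal =
        ∫ x, |(A n)ᶜ.indicator (F.pointwiseNorm v) x| ^ p.toReal ∂m := by
      intro n
      rw [← norm_pointwiseNorm, Lp_norm_rpow_eq_integral hp1 hp]
      refine integral_congr_ae ?_
      filter_upwards [F.ae_pointwiseNorm_chi_mul_sub (hA n) v] with x hx
      rw [hx]
    simp only [h2]
    have h3 : (0 : ℝ) = ∫ _ : M, (0 : ℝ) ∂m := by simp
    rw [h3]
    refine tendsto_integral_of_dominated_convergence
      (fun x => |F.pointwiseNorm v x| ^ p.toReal) (fun n => ?_)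
      ((Lp.memLp (F.pointwiseNorm v)).integrable_norm_rpow hp0 hp) (fun n => ?_) ?_
    · have h4 := ((Lp.stronglyMeasurable (F.pointwiseNorm v)).measurable.indicator (hA n).compl)
      exact ((continuous_abs.measurable.comp h4).pow_const p.toReal).aestronglyMeasurable
    · refine ae_of_all _ fun x => ?_
      rw [Real.norm_of_nonneg (by positivity)]
      refine Real.rpow_le_rpow (abs_nonneg _) ?_ hr.le
      by_cases hx : x ∈ (A n)ᶜ <;> simp [hx]
    · refine ae_of_all _ fun x => ?_
      obtain ⟨N, hN⟩ := mem_iUnion.1 (hU ▸ mem_univ x)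
      refine tendsto_const_nhds.congr' (eventually_atTop.2 ⟨N, fun n hn => ?_⟩)
      have : x ∈ A n := hmono hn hN
      simp [this, Real.zero_rpow hr.ne']
  rw [tendsto_iff_norm_sub_tendsto_zero]
  have h5 := h1.rpow_const (p := p.toReal⁻¹) (Or.inr (by positivity))
  rw [Real.zero_rpow (inv_ne_zero hr.ne')] at h5
  refine h5.congr fun n => ?_
  rw [← Real.rpow_mul (norm_nonneg _), mul_inv_cancel₀ hr.ne', Real.rpow_one]

theorem Pfm.isCountablyValued {F : LpFunctional m p V} (s : F.Pfm) : IsCountablyValued s.val :=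
  s.2.1

/-- On the piece where `s` takes the value `v`, the difference of the two families is the zero
vector, and `g` vanishes a.e. at zero. -/
theorem chi_mul_coe_eq_chi_mul_d (s : F.Pfm) (v : V) :
    F.linftyMul (chi m (s.isCountablyValued.2 v)) s =
      F.linftyMul (chi m (s.isCountablyValued.2 v)) (F.d v) := by
  rw [chi_mul_eq_iff, d, ← UniformSpace.Completion.coe_sub, pointwiseNorm_coe]
  have hg : ∀ᵐ x ∂m, F.g 0 x = 0 := by
    rw [F.g_zero]; exact Lp.coeFn_zero _ _ _
  filter_upwards [(s - F.dPfm v).coeFn_pointwiseNorm, hg] with x hx h0 hxv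
  have e : (s - F.dPfm v).val x = 0 := sub_eq_zero.2 hxv
  rw [hx, pointwise, e, h0]

/-- The differentials generate the module: a closed subspace which contains them and is stable
under multiplication by characteristic functions is everything. -/
theorem eq_top_of_d_mem (hp1 : 1 < p) (hp : p ≠ ∞) {N : Submodule ℝ F.LpModule}
    (hN : IsClosed (N : Set F.LpModule))
    (hmul : ∀ (A : Set M) (hA : MeasurableSet A), ∀ v ∈ N, F.linftyMul (chi m hA) v ∈ N)
    (hd : ∀ f, F.d f ∈ N) : N = ⊤ := by
  classical
  rw [Submodule.eq_top_iff']
  intro w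
  induction w using UniformSpace.Completion.induction_on with
  | hp => exact hN
  | ih s =>
    have hpre : ∀ B : Set V, MeasurableSet (s.val ⁻¹' B) :=
      s.isCountablyValued.measurableSet_preimage
    -- The part of `s` with values in a finite set is a finite sum of localized differentials, hence
    -- in `N`. Exhausting the countable range and letting the cut-off tend to `s` gives all
    -- families, which are dense.
    have hfin : ∀ T : Finset V, F.linftyMul (chi m (hpre T)) s ∈ N := by
      intro T
      induction T using Finset.induction_on with
      | empty =>
        have : F.linftyMul (chi m (hpre (∅ : Finset V))) (s : F.LpModule) = 0 := by
          rw [chi_mul_eq_zero_iff]; simp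
        rw [this]; exact N.zero_mem
      | insert v T hv ih =>
        have hchi : chi m (hpre (insert v T : Finset V)) =
            chi m (s.isCountablyValued.2 v) + chi m (hpre T) := by
          refine Lp.ext ?_
          filter_upwards [coeFn_chi (m := m) (hpre (insert v T : Finset V)),
            coeFn_chi (m := m) (s.isCountablyValued.2 v), coeFn_chi (m := m) (hpre T),
            Lp.coeFn_add (chi m (s.isCountablyValued.2 v)) (chi m (hpre T))] with x h1 h2 h3 h4
          rw [h1, h4, Pi.add_apply, h2, h3]
          by_cases hx : s.val x = v
          · have h5 : s.val x ∉ T := hx ▸ hv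
            have h6 : x ∈ s.val ⁻¹' {v} := hx
            rw [indicator_of_mem h6, indicator_of_mem (by simp [hx]),
              indicator_of_notMem (by simpa using h5), add_zero]
          · have h6 : x ∉ s.val ⁻¹' {v} := hx
            rw [indicator_of_notMem h6, zero_add]
            simp [indicator, hx]
        rw [hchi, add_linftyMul, chi_mul_coe_eq_chi_mul_d]
        exact N.add_mem (hmul _ _ _ (hd v)) ih
    -- Enumerating the range of `s` by `ℕ` requires it to be nonempty.
    rcases isEmpty_or_nonempty M with hM | hM
    · have : (s : F.LpModule) = 0 := by
        rw [eq_zero_iff_pointwiseNorm]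
        exact ae_of_all _ hM.elim
      rw [this]; exact N.zero_mem
    · obtain ⟨e, he⟩ := s.2.1.1.exists_eq_range (range_nonempty _)
      refine hN.mem_of_tendsto (F.tendsto_chi_mul hp1 hp
        (fun n => hpre ((Finset.range n).image e)) (fun n k hnk => ?_) ?_ s)
        (Eventually.of_forall fun n => hfin _)
      · exact preimage_mono (Finset.coe_subset.2 (Finset.image_mono e (Finset.range_mono hnk)))
      · refine eq_univ_of_forall fun x => ?_
        obtain ⟨n, hn⟩ : s.val x ∈ range e := he ▸ mem_range_self x
        refine mem_iUnion.2 ⟨n + 1, ?_⟩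
        simp only [mem_preimage, Finset.coe_image, mem_image]
        exact ⟨n, by simp, hn⟩

/-- Sequences whose pointwise norms are increasing, bounded and additive on differences are
convergent. -/
theorem cauchySeq_of_pointwiseNorm_sub (hp1 : 1 < p) (hp : p ≠ ∞) {w : ℕ → F.LpModule} {C : ℝ}
    (hC : ∀ n, ‖w n‖ ≤ C)
    (hw : ∀ n k, n ≤ k → F.pointwiseNorm (w k - w n) =
      F.pointwiseNorm (w k) - F.pointwiseNorm (w n)) : CauchySeq w := by
  have hmono : Monotone fun n => F.pointwiseNorm (w n) := fun n k hnk => by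
    rw [← sub_nonneg, ← hw n k hnk]; exact F.pointwiseNorm_nonneg _
  have hnmono : Monotone fun n => ‖F.pointwiseNorm (w n)‖ := fun n k hnk =>
    Lp_norm_mono (F.pointwiseNorm_nonneg _) (hmono hnk)
  have hbdd : BddAbove (range fun n => ‖F.pointwiseNorm (w n)‖) := by
    refine ⟨C, ?_⟩
    rintro _ ⟨n, rfl⟩
    exact (F.norm_pointwiseNorm _).trans_le (hC n)
  have hlim := tendsto_atTop_ciSup hnmono hbdd
  have hcau : CauchySeq fun n => F.pointwiseNorm (w n) := by
    refine Lp_cauchySeq_of_midpoint hp1 hp (fun n => F.pointwiseNorm_nonneg _) hlim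
      (fun n => norm_nonneg _) hlim fun n k hnk => ?_
    -- For `n ≤ k` the midpoint dominates the smaller pointwise norm, so monotonicity supplies the
    -- midpoint bound required by uniform convexity.
    refine Lp_norm_mono (F.pointwiseNorm_nonneg _) ?_
    have h1 : F.pointwiseNorm (w n) =
        (2⁻¹ : ℝ) • (F.pointwiseNorm (w n) + F.pointwiseNorm (w n)) := by
      rw [← two_smul ℝ (F.pointwiseNorm (w n)), smul_smul]; norm_num
    conv_lhs => rw [h1]
    exact Lp_smul_le (by norm_num) (add_le_add_right (hmono hnk) _)
  rw [Metric.cauchySeq_iff'] at hcau ⊢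
  intro ε hε
  obtain ⟨N, hN⟩ := hcau ε hε
  refine ⟨N, fun n hn => ?_⟩
  have := hN n hn
  rwa [dist_eq_norm, ← hw N n hn, norm_pointwiseNorm, ← dist_eq_norm] at this

/-- Glueing of finitely many compatible elements. -/
theorem exists_glue_finite {N : Submodule ℝ F.LpModule}
    (hmul : ∀ (A : Set M) (hA : MeasurableSet A), ∀ v ∈ N, F.linftyMul (chi m hA) v ∈ N)
    {v : ℕ → F.LpModule} {A : ℕ → Set M} (hA : ∀ n, MeasurableSet (A n)) (hv : ∀ n, v n ∈ N)
    (hcomp : ∀ i j, F.linftyMul (chi m ((hA i).inter (hA j))) (v i) =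
      F.linftyMul (chi m ((hA i).inter (hA j))) (v j)) (n : ℕ) :
    ∃ w ∈ N, (∀ᵐ x ∂m, ∀ i < n, x ∈ A i → F.pointwiseNorm (w - v i) x = 0) ∧
      ∀ᵐ x ∂m, (∀ i < n, x ∉ A i) → F.pointwiseNorm w x = 0 := by
  have hcomp' : ∀ᵐ x ∂m, ∀ i j, x ∈ A i → x ∈ A j → F.pointwiseNorm (v i - v j) x = 0 := by
    refine ae_all_iff.2 fun i => ae_all_iff.2 fun j => ?_
    filter_upwards [(F.chi_mul_eq_iff ((hA i).inter (hA j)) _ _).1 (hcomp i j)] with x h hi hj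
      using h ⟨hi, hj⟩
  induction n with
  | zero =>
    refine ⟨0, N.zero_mem, by simp, ?_⟩
    filter_upwards [(F.eq_zero_iff_pointwiseNorm 0).1 rfl] with x hx _ using hx
  | succ n ih =>
    obtain ⟨w, hwN, hw1, hw2⟩ := ih
    set U : Set M := ⋃ i ∈ Finset.range n, A i with hU
    have hUm : MeasurableSet U := MeasurableSet.biUnion (Finset.countable_toSet _) fun i _ => hA i
    have hmU : ∀ x, x ∈ U ↔ ∃ i < n, x ∈ A i := fun x => by simp [hU]
    -- The new element is added only where nothing has been prescribed yet, so no earlier value is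
    -- disturbed.
    set D : Set M := A n \ U
    have hD : MeasurableSet D := (hA n).diff hUm
    set z := F.linftyMul (chi m hD) (v n)
    have hz1 : ∀ᵐ x ∂m, F.pointwiseNorm z x = D.indicator (F.pointwiseNorm (v n)) x :=
      F.ae_pointwiseNorm_chi_mul hD (v n)
    have hz2 : ∀ᵐ x ∂m, F.pointwiseNorm (z - v n) x = Dᶜ.indicator (F.pointwiseNorm (v n)) x :=
      F.ae_pointwiseNorm_chi_mul_sub hD (v n)
    have hle1 : ∀ᵐ x ∂m, ∀ i, F.pointwiseNorm (w + z - v i) x ≤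
        F.pointwiseNorm (w - v i) x + F.pointwiseNorm z x := by
      refine ae_all_iff.2 fun i => ?_
      have := F.ae_pointwiseNorm_add_le (w - v i) z
      rwa [sub_add_eq_add_sub] at this
    have hle2 : ∀ᵐ x ∂m, F.pointwiseNorm (w + z - v n) x ≤
        F.pointwiseNorm w x + F.pointwiseNorm (z - v n) x := by
      have := F.ae_pointwiseNorm_add_le w (z - v n)
      rwa [← add_sub_assoc] at this
    have hle3 : ∀ᵐ x ∂m, ∀ i, F.pointwiseNorm (w - v n) x ≤
        F.pointwiseNorm (w - v i) x + F.pointwiseNorm (v i - v n) x :=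
      ae_all_iff.2 fun i => F.ae_pointwiseNorm_sub_le w (v i) (v n)
    have hnn : ∀ᵐ x ∂m, ∀ i, 0 ≤ F.pointwiseNorm (w + z - v i) x :=
      ae_all_iff.2 fun i => F.ae_pointwiseNorm_nonneg _
    refine ⟨w + z, N.add_mem hwN (hmul _ _ _ (hv n)), ?_, ?_⟩
    · filter_upwards [hw1, hw2, hz1, hz2, hle1, hle2, hle3, hnn, hcomp']
        with x h1 h2 h3 h4 h5 h6 h7 h8 h9 i hi hxi
      refine le_antisymm ?_ (h8 i)
      by_cases hxU : x ∈ U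
      · have hxD : x ∉ D := fun h => h.2 hxU
        rw [indicator_of_notMem hxD] at h3
        rcases Nat.lt_succ_iff_lt_or_eq.1 hi with h | rfl
        · have := h5 i
          rwa [h1 i h hxi, h3, add_zero] at this
        -- On the overlap with an earlier `A j`, `w` already equals `v j`, and compatibility
        -- identifies `v j` with the new `v i`.
        · obtain ⟨j, hj, hxj⟩ := (hmU x).1 hxU
          have e1 := h5 i
          have e2 := h7 j
          rw [h1 j hj hxj, h9 j i hxj hxi] at e2
          linarith
      · have hall : ∀ j < n, x ∉ A j := fun j hj hxj => hxU ((hmU x).2 ⟨j, hj, hxj⟩)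
        rcases Nat.lt_succ_iff_lt_or_eq.1 hi with h | rfl
        · exact absurd hxi (hall i h)
        · have hxD : x ∉ Dᶜ := fun h => h ⟨hxi, hxU⟩
          rwa [h2 hall, h4, indicator_of_notMem hxD, add_zero] at h6
    · filter_upwards [hw2, hz1, F.ae_pointwiseNorm_add_le w z, F.ae_pointwiseNorm_nonneg (w + z)]
        with x h2 h3 h4 h5 hall
      have hxD : x ∉ D := fun h => hall n n.lt_succ_self h.1
      rw [h2 fun i hi => hall i (hi.trans n.lt_succ_self), h3, indicator_of_notMem hxD,
        add_zero] at h4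
      exact le_antisymm h4 h5

/-- The finite glueings `w n` vanish off the first `n` sets and agree with earlier ones on their
support sets, so their pointwise norms increase and are additive on differences. Boundedness then
gives a limit, which is the glued element. The sets may overlap, so the partial sums in the
hypothesis are not the `w n` themselves and have to be compared with them. -/
theorem exists_glue (hp1 : 1 < p) (hp : p ≠ ∞) {N : Submodule ℝ F.LpModule}
    (hN : IsClosed (N : Set F.LpModule))
    (hmul : ∀ (A : Set M) (hA : MeasurableSet A), ∀ v ∈ N, F.linftyMul (chi m hA) v ∈ N)
    {v : ℕ → F.LpModule} {A : ℕ → Set M} (hA : ∀ n, MeasurableSet (A n)) (hv : ∀ n, v n ∈ N)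
    (hcomp : ∀ i j, F.linftyMul (chi m ((hA i).inter (hA j))) (v i) =
      F.linftyMul (chi m ((hA i).inter (hA j))) (v j))
    (hlim : limsup (fun n => ‖∑ i ∈ Finset.range n, F.linftyMul (chi m (hA i)) (v i)‖ₑ)
      atTop < ∞) :
    ∃ w ∈ N, (∀ i, F.linftyMul (chi m (hA i)) w = F.linftyMul (chi m (hA i)) (v i)) ∧
      ‖w‖ₑ ≤
        liminf (fun n => ‖∑ i ∈ Finset.range n, F.linftyMul (chi m (hA i)) (v i)‖ₑ) atTop := by
  choose w hwN hw1 hw2 using F.exists_glue_finite hmul hA hv hcomp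
  have hmulw : ∀ n, ∀ i < n, F.linftyMul (chi m (hA i)) (w n) =
      F.linftyMul (chi m (hA i)) (v i) := by
    intro n i hi
    rw [chi_mul_eq_iff]
    filter_upwards [hw1 n] with x hx using hx i hi
  set S : ℕ → F.LpModule := fun n => ∑ i ∈ Finset.range n, F.linftyMul (chi m (hA i)) (v i)
  have hle : ∀ n, ‖w n‖ ≤ ‖S n‖ := by
    intro n
    have hsum : ∀ (T : Finset ℕ) (u : F.LpModule), ∑ i ∈ T, F.linftyMul (chi m (hA i)) u =
        F.linftyMul (∑ i ∈ T, chi m (hA i)) u := by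
      intro T u
      induction T using Finset.cons_induction with
      | empty =>
        have h0 : F.linftyMul ((0 : ℝ) • (0 : Lp ℝ ∞ m)) u = 0 := by
          rw [smul_linftyMul, zero_smul]
        rw [zero_smul] at h0
        simp [h0]
      | cons i T hi ih => rw [Finset.sum_cons, Finset.sum_cons, add_linftyMul, ih]
    -- The partial sum is `w n` multiplied by the number of sets covering each point. This
    -- multiplicity is at least `1` on the union, and `w n` vanishes elsewhere, so `S n` dominates
    -- `w n` pointwise.
    have hS : S n = F.linftyMul (∑ i ∈ Finset.range n, chi m (hA i)) (w n) := by
      rw [← hsum]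
      exact Finset.sum_congr rfl fun i hi => (hmulw n i (Finset.mem_range.1 hi)).symm
    rw [← norm_pointwiseNorm, ← norm_pointwiseNorm]
    refine Lp_norm_mono (F.pointwiseNorm_nonneg _) ?_
    rw [← Lp.coeFn_le, hS]
    have hchi : ∀ᵐ x ∂m, (∑ i ∈ Finset.range n, chi m (hA i) : Lp ℝ ∞ m) x =
        ∑ i ∈ Finset.range n, (A i).indicator (fun _ => (1 : ℝ)) x := by
      have h1 := Lp.coeFn_finsetSum (Finset.range n) fun i => chi m (hA i)
      filter_upwards [h1, ae_all_iff.2 fun i => coeFn_chi (m := m) (hA i)] with x h1 h2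
      rw [h1, Finset.sum_apply]
      exact Finset.sum_congr rfl fun i _ => h2 i
    filter_upwards [F.ae_pointwiseNorm_linftyMul (∑ i ∈ Finset.range n, chi m (hA i)) (w n),
      hchi, hw2 n, F.ae_pointwiseNorm_nonneg (w n)] with x h1 h2 h3 h4
    rw [h1, h2]
    by_cases hx : ∀ i < n, x ∉ A i
    · rw [h3 hx, mul_zero]
    · push Not at hx
      obtain ⟨i, hi, hxi⟩ := hx
      refine le_mul_of_one_le_left h4 (le_trans ?_ (le_abs_self _))
      have h5 : (A i).indicator (fun _ => (1 : ℝ)) x = 1 := indicator_of_mem hxi _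
      exact h5.symm.trans_le <| Finset.single_le_sum
        (f := fun i => (A i).indicator (fun _ => (1 : ℝ)) x)
        (fun j _ => indicator_nonneg (fun _ _ => zero_le_one) x) (Finset.mem_range.2 hi)
  have hsub : ∀ k n, k ≤ n → F.pointwiseNorm (w n - w k) =
      F.pointwiseNorm (w n) - F.pointwiseNorm (w k) := by
    intro k n hkn
    refine Lp.ext ?_
    have hle1 : ∀ᵐ x ∂m, ∀ i, F.pointwiseNorm (w n - w k) x ≤
        F.pointwiseNorm (w n - v i) x + F.pointwiseNorm (v i - w k) x :=
      ae_all_iff.2 fun i => F.ae_pointwiseNorm_sub_le (w n) (v i) (w k)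
    have hle2 := F.ae_pointwiseNorm_add_le (w n - w k) (w k)
    have hle3 := F.ae_pointwiseNorm_add_le (w k - w n) (w n)
    rw [sub_add_cancel] at hle2 hle3
    rw [F.pointwiseNorm_sub_comm] at hle3
    have hle4 := F.ae_pointwiseNorm_sub_le (w n) 0 (w k)
    rw [sub_zero, zero_sub, pointwiseNorm_neg] at hle4
    have hcomm : ∀ᵐ x ∂m, ∀ i, F.pointwiseNorm (v i - w k) x = F.pointwiseNorm (w k - v i) x :=
      ae_of_all _ fun x i => by rw [F.pointwiseNorm_sub_comm]
    filter_upwards [hw1 n, hw1 k, hw2 k, hle1, hle2, hle3, hle4, hcomm,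
      Lp.coeFn_sub (F.pointwiseNorm (w n)) (F.pointwiseNorm (w k)),
      F.ae_pointwiseNorm_nonneg (w n - w k)] with x h1 h2 h3 h4 h5 h6 h11 h7 h8 h9
    rw [h8, Pi.sub_apply]
    -- Off the first `k` sets `w k` vanishes and the difference has the norm of `w n`; on them `w n`
    -- and `w k` agree, so the difference vanishes and their norms coincide.
    by_cases hx : ∀ i < k, x ∉ A i
    · have := h3 hx
      linarith
    · push Not at hx
      obtain ⟨i, hi, hxi⟩ := hx
      have h10 := h4 i
      rw [h7, h1 i (hi.trans_le hkn) hxi, h2 i hi hxi] at h10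
      linarith
  have hbdd : ∃ C, ∀ n, ‖w n‖ ≤ C := by
    obtain ⟨c, hc1, hc2⟩ := exists_between hlim
    obtain ⟨K, hK⟩ := eventually_atTop.1 (eventually_lt_of_limsup_lt hc1)
    refine ⟨c.toReal, fun n => ?_⟩
    -- The upper limit controls only large indices; monotonicity of the norms extends the bound to
    -- all `n`.
    have h1 : ‖w n‖ ≤ ‖w (max n K)‖ := by
      rw [← norm_pointwiseNorm, ← F.norm_pointwiseNorm (w (max n K))]
      refine Lp_norm_mono (F.pointwiseNorm_nonneg _) ?_
      rw [← sub_nonneg, ← hsub n _ (le_max_left n K)]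
      exact F.pointwiseNorm_nonneg _
    refine h1.trans ((hle _).trans ?_)
    rw [← toReal_enorm]
    exact ENNReal.toReal_mono hc2.ne (hK _ (le_max_right n K)).le
  obtain ⟨C, hC⟩ := hbdd
  obtain ⟨W, hW⟩ := cauchySeq_tendsto_of_complete
    (F.cauchySeq_of_pointwiseNorm_sub hp1 hp hC hsub)
  refine ⟨W, hN.mem_of_tendsto hW (Eventually.of_forall hwN), fun i => ?_, ?_⟩
  · refine tendsto_nhds_unique (((F.continuous_linftyMul _).tendsto W).comp hW)
      (tendsto_const_nhds.congr' (eventually_atTop.2 ⟨i + 1, fun n hn => ?_⟩))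
    exact (hmulw n i hn).symm
  · rw [← hW.enorm.liminf_eq]
    refine liminf_le_liminf (Eventually.of_forall fun n => ?_)
    simp only [← ofReal_norm]
    exact ENNReal.ofReal_le_ofReal (hle n)

/-- Closed subspaces stable under multiplication are `L^p`-normed modules. -/
theorem isSubmodule_of_isClosed (hp1 : 1 < p) (hp : p ≠ ∞) {N : Submodule ℝ F.LpModule}
    (hN : IsClosed (N : Set F.LpModule))
    (hmul : ∀ (a : Lp ℝ ∞ m), ∀ v ∈ N, F.linftyMul a v ∈ N) : F.IsSubmodule N where
  isClosed := hN
  mul_mem := hmul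
  add_mul a b v _ := F.add_linftyMul a b v
  smul_mul c a v _ := F.smul_linftyMul c a v
  mul_add a v _ w _ := F.linftyMul_add a v w
  mul_smul c a v _ := F.linftyMul_smul c a v
  mul_mul a b v _ := F.mul_linftyMul a b v
  one_mul v _ := F.linftyMul_chi_univ v
  norm_eq v _ := (F.norm_pointwiseNorm v).symm
  pointwiseNorm_mul a v _ := F.pointwiseNorm_linftyMul a v
  locality _ _ _ hA h := F.chi_mul_iUnion_eq_zero hA h
  glueing _ _ hA hv hcomp hlim :=
    F.exists_glue hp1 hp hN (fun _ hB => hmul (chi m hB)) hA hv hcomp hlim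

end Generation

/-! ### Embeddings -/

section Embedding
variable {M : Type*} [MeasurableSpace M] {m : Measure M} {p : ℝ≥0∞} [Fact (1 ≤ p)]
  {V : Type*} [AddCommGroup V] [Module ℝ V] {V' : Type*} [AddCommGroup V'] [Module ℝ V']
  (F : LpFunctional m p V) (F' : LpFunctional m p V')

theorem IsCountablyValued.map {W W' : Type*} {s : M → W} (hs : IsCountablyValued s) (φ : W → W') :
    IsCountablyValued fun x => φ (s x) :=
  hs.comp₂ (isCountablyValued_const ()) fun w _ => φ w

variable {F F'} in
theorem pointwise_map {j : V → V'} (hj : ∀ f, F'.g (j f) = F.g f) (s : M → V) :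
    F'.pointwise (fun x => j (s x)) = F.pointwise s :=
  funext fun x => by rw [pointwise, pointwise, hj]

/-- The map `{(f_i, A_i)} ↦ {(j f_i, A_i)}` for a linear map `j` preserving the functionals. -/
noncomputable def mapPfm (j : V →ₗ[ℝ] V') (hj : ∀ f, F'.g (j f) = F.g f) : F.Pfm →ₗ[ℝ] F'.Pfm where
  toFun s := ⟨fun x => j (s.val x), s.2.1.map j, by rw [pointwise_map hj]; exact s.2.2⟩
  map_add' s t := Subtype.ext <| funext fun x => map_add j (s.val x) (t.val x)
  map_smul' c s := Subtype.ext <| funext fun x => map_smul j c (s.val x)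

theorem pointwiseNorm_mapPfm (j : V →ₗ[ℝ] V') (hj : ∀ f, F'.g (j f) = F.g f) (s : F.Pfm) :
    (F.mapPfm F' j hj s).pointwiseNorm = s.pointwiseNorm := by
  refine Lp.ext ?_
  filter_upwards [(F.mapPfm F' j hj s).coeFn_pointwiseNorm, s.coeFn_pointwiseNorm] with x h1 h2
  rw [h1, h2]
  exact congrFun (pointwise_map hj s.val) x

/-- Applying `j` value by value keeps the pointwise norm, because `j` preserves the functionals. It
is therefore isometric on families and extends to the completions, where the algebraic properties
persist by density. -/
theorem exists_isModuleEmbedding (j : V →ₗ[ℝ] V') (hj : ∀ f, F'.g (j f) = F.g f) :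
    ∃ i : F.LpModule →ₗᵢ[ℝ] F'.LpModule, F.IsModuleEmbedding F' j i := by
  set J := F.mapPfm F' j hj
  have hJn : ∀ s, ‖J s‖ = ‖s‖ := fun s => by
    rw [Pfm.norm_def, Pfm.norm_def, pointwiseNorm_mapPfm]
  have hJ : UniformContinuous J := (AddMonoidHomClass.isometry_of_norm J hJn).uniformContinuous
  set I : F.LpModule → F'.LpModule := UniformSpace.Completion.map J
  have hI : Continuous I := UniformSpace.Completion.continuous_map
  have hIc : ∀ s : F.Pfm, I (s : F.LpModule) = (J s : F'.Pfm) := UniformSpace.Completion.map_coe hJ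
  have hadd : ∀ v w, I (v + w) = I v + I w := by
    intro v w
    induction v, w using UniformSpace.Completion.induction_on₂ with
    | hp =>
      exact isClosed_eq (hI.comp (continuous_fst.add continuous_snd))
        ((hI.comp continuous_fst).add (hI.comp continuous_snd))
    | ih s t =>
      rw [← UniformSpace.Completion.coe_add]
      simp only [hIc]
      rw [map_add, UniformSpace.Completion.coe_add]
  have hsmul : ∀ (c : ℝ) v, I (c • v) = c • I v := by
    intro c v
    induction v using UniformSpace.Completion.induction_on with
    | hp => exact isClosed_eq (hI.comp (continuous_const_smul c)) (hI.const_smul c)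
    | ih s =>
      rw [← UniformSpace.Completion.coe_smul]
      simp only [hIc]
      rw [map_smul, UniformSpace.Completion.coe_smul]
  have hnorm : ∀ v, F'.pointwiseNorm (I v) = F.pointwiseNorm v := by
    intro v
    induction v using UniformSpace.Completion.induction_on with
    | hp =>
      exact isClosed_eq (F'.continuous_pointwiseNorm.comp hI) F.continuous_pointwiseNorm
    | ih s =>
      rw [hIc, pointwiseNorm_coe, pointwiseNorm_coe]
      exact F.pointwiseNorm_mapPfm F' j hj s
  refine ⟨{ toFun := I, map_add' := hadd, map_smul' := hsmul, norm_map' := fun v => ?_ },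
    fun a v => ?_, hnorm, fun f => hIc (F.dPfm f)⟩
  · rw [← norm_pointwiseNorm, ← F.norm_pointwiseNorm v]
    exact congrArg norm (hnorm v)
  · change I (F.linftyMul a v) = F'.linftyMul a (I v)
    induction v using UniformSpace.Completion.induction_on with
    | hp =>
      exact isClosed_eq (hI.comp (F.continuous_linftyMul a)) ((F'.continuous_linftyMul a).comp hI)
    | ih s =>
      rw [hIc]
      -- By linearity of `j`, the map on families commutes exactly with each countably valued
      -- multiplication, and both sides are limits of the same sequence.
      refine tendsto_nhds_unique ((hI.tendsto _).comp (F.tendsto_approxMul_coe a s))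
        ((F'.tendsto_approxMul_coe a (J s)).congr fun n => ?_)
      rw [Function.comp_apply, hIc]
      congr 1
      exact Subtype.ext (funext fun x => (map_smul j _ _).symm)

variable {F F'}

/-- The set where two embeddings agree is a closed subspace, stable under characteristic functions
and containing all differentials, so generation applies. -/
theorem IsModuleEmbedding.unique (hp1 : 1 < p) (hp : p ≠ ∞) {j : V →ₗ[ℝ] V'}
    {i i' : F.LpModule →ₗᵢ[ℝ] F'.LpModule} (hi : F.IsModuleEmbedding F' j i)
    (hi' : F.IsModuleEmbedding F' j i') : i' = i := by
  have h : LinearMap.eqLocus i'.toLinearMap i.toLinearMap = ⊤ := by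
    refine F.eq_top_of_d_mem hp1 hp (isClosed_eq i'.continuous i.continuous) (fun A hA v hv => ?_)
      fun f => (hi'.map_d f).trans (hi.map_d f).symm
    have hv' : i' v = i v := hv
    change i' _ = i _
    rw [hi'.map_mul, hi.map_mul, hv']
  refine LinearIsometry.ext fun v => ?_
  have hv : v ∈ LinearMap.eqLocus i'.toLinearMap i.toLinearMap := h ▸ Submodule.mem_top
  exact hv

theorem isClosed_range_linearIsometry (i : F.LpModule →ₗᵢ[ℝ] F'.LpModule) :
    IsClosed (LinearMap.range i.toLinearMap : Set F'.LpModule) :=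
  i.isometry.isClosedEmbedding.isClosed_range

theorem IsModuleEmbedding.linftyMul_mem_range {j : V →ₗ[ℝ] V'}
    {i : F.LpModule →ₗᵢ[ℝ] F'.LpModule} (hi : F.IsModuleEmbedding F' j i) (a : Lp ℝ ∞ m) :
    ∀ v ∈ LinearMap.range i.toLinearMap, F'.linftyMul a v ∈ LinearMap.range i.toLinearMap := by
  rintro _ ⟨v, rfl⟩
  exact ⟨F.linftyMul a v, hi.map_mul a v⟩

/-- The image of an isometry from a complete space is closed, so by density it contains every
differential of the target, and generation applies there. -/
theorem IsModuleEmbedding.range_eq_top (hp1 : 1 < p) (hp : p ≠ ∞) {j : V →ₗ[ℝ] V'}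
    {i : F.LpModule →ₗᵢ[ℝ] F'.LpModule} (hi : F.IsModuleEmbedding F' j i)
    (hd : ∀ f, F'.d f ∈ closure (range fun h => F'.d (j h))) :
    LinearMap.range i.toLinearMap = ⊤ := by
  refine F'.eq_top_of_d_mem hp1 hp (isClosed_range_linearIsometry i)
    (fun A hA => hi.linftyMul_mem_range (chi m hA)) fun f => ?_
  refine closure_minimal ?_ (isClosed_range_linearIsometry i) (hd f)
  rintro _ ⟨h, rfl⟩
  exact ⟨F.d h, hi.map_d h⟩

end Embedding

end LpFunctional

/-! ### The Lipschitz energy and the theorem -/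

/-- The extended slope of a Lipschitz function is finite, so nothing is lost in passing to its
real-valued `L^p` class. -/
theorem lintegral_elip_rpow {M : Type*} [MetricSpace M] [MeasurableSpace M] [BorelSpace M]
    {m : Measure M} {p : ℝ≥0∞} [Fact (1 ≤ p)] (f : lipDomain m p) :
    ∫⁻ x, elip (f : M → ℝ) x ^ p.toReal ∂m =
      ∫⁻ x, ‖(lipFunctional m p).g f x‖ₑ ^ p.toReal ∂m := by
  refine lintegral_congr_ae ?_
  filter_upwards [MemLp.coeFn_toLp f.2.2] with x hx
  have h : (lipFunctional m p).g f x = lip (f : M → ℝ) x := hx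
  rw [h, Real.enorm_of_nonneg (lip_nonneg _ _), lip, ENNReal.ofReal_toReal (elip_ne_top f.2.1 x)]

theorem mainTheorem9 {M : Type*} [MetricSpace M] [CompleteSpace M] [MeasurableSpace M]
    [BorelSpace M] (m : Measure M) [m.Regular] [IsFiniteOnBounded m]
    (p : ℝ≥0∞) [Fact (1 ≤ p)] (hp1 : 1 < p) (hp : p ≠ ∞)
    (hstrong : ∀ G : Lp ℝ p m, (lipFunctional m p).IsStrongUpperRelaxation 0 G → G = 0) :
    -- lower semicontinuity of the Lipschitz energy on its domain, with respect to `L^0(m)`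
    (∀ (u : ℕ → lipDomain m p) (f : lipDomain m p),
      (lipFunctional m p).ConvergesTo u ((lipFunctional m p).toL0 f) →
        ∫⁻ x, elip (f : M → ℝ) x ^ p.toReal ∂m ≤
          liminf (fun n => ∫⁻ x, elip (u n : M → ℝ) x ^ p.toReal ∂m) atTop) ∧
    -- the Lipschitz differential is closable
    (lipFunctional m p).IsClosable ∧
    -- the Lipschitz module is a submodule of the cotangent module
    ∃ i : LipschitzModule m p →ₗᵢ[ℝ] CotangentModule m p hp1 hp,
      (lipFunctional m p).IsModuleEmbedding (relaxedSlope m p hp1 hp)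
        ((lipFunctional m p).toRelaxDomain hp1 hp) i ∧
      (∀ i' : LipschitzModule m p →ₗᵢ[ℝ] CotangentModule m p hp1 hp,
        (lipFunctional m p).IsModuleEmbedding (relaxedSlope m p hp1 hp)
          ((lipFunctional m p).toRelaxDomain hp1 hp) i' → i' = i) ∧
      (relaxedSlope m p hp1 hp).IsSubmodule (LinearMap.range i.toLinearMap) ∧
      -- if differentials of Lipschitz functions are dense among Sobolev differentials,
      -- then the two modules agree
      ((∀ f : (lipFunctional m p).relaxDomain hp1 hp,
        (relaxedSlope m p hp1 hp).d f ∈ closure (range fun h : lipDomain m p =>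
          (relaxedSlope m p hp1 hp).d ((lipFunctional m p).toRelaxDomain hp1 hp h))) →
        LinearMap.range i.toLinearMap = ⊤) := by
  refine ⟨fun u f hu => ?_, (lipFunctional m p).isClosable_of_strongUpperRelaxation hp1 hp hstrong,
    ?_⟩
  · simp only [lintegral_elip_rpow]
    exact (lipFunctional m p).lintegral_g_le_liminf hp1 hp hstrong hu
  -- The equality of the relaxed slope and `lip` on Lipschitz functions is exactly the compatibility
  -- needed to construct the embedding.
  · obtain ⟨i, hi⟩ := (lipFunctional m p).exists_isModuleEmbedding (relaxedSlope m p hp1 hp)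
      ((lipFunctional m p).toRelaxDomain hp1 hp)
      fun f => (lipFunctional m p).lowerRelax_toL0 hp1 hp hstrong f
    exact ⟨i, hi, fun i' hi' => hi.unique hp1 hp hi',
      (relaxedSlope m p hp1 hp).isSubmodule_of_isClosed hp1 hp
        (LpFunctional.isClosed_range_linearIsometry i) hi.linftyMul_mem_range,
      hi.range_eq_top hp1 hp⟩
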